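/- **Setting.** Let $V\hookrightarrow H\hookrightarrow V'$ be a normal triple of real Hilbert spaces (dense continuous embeddings, $V'$ is the dual of $V$ relative to the inner product of $H$), let $T>0$, and put $\mathcal V(T)=L_2((0,T);V)$, $\mathcal V'(T)=L_2((0,T);V')$. Let $\mathcal U$ be a real Hilbert space with an orthonormal basis $\{\mathfrak u_k\}_{k\ge1}$, and let $\dot W=\{\dot W(h),h\in\mathcal U\}$ be a zero-mean Gaussian family on a probability space with $\mathbb E\,\dot W(h)\dot W(g)=(h,g)_{\mathcal U}$. For multi-indices $\alpha=(\alpha_1,\alpha_2,\dots)$ with $|\alpha|=\sum_k\alpha_k<\infty$ let $\xi_\alpha=\prod_k H_{\alpha_k}(\dot W(\mathfrak u_k))/\sqrt{\alpha_k!}$ ($H_n$ the probabilists' Hermite polynomials). A weight sequence is $Q=\{q_k\}$ with $q_k\ge1$; put $q^{s\alpha}=\prod_kq_k^{s\alpha_k}$. For a Hilbert space $X$ and real $s$, $(\mathcal L)_{Q,s}(X)$ is the space of formal series $\eta=\sum_\alpha\eta_\alpha\xi_\alpha$, $\eta_\alpha\in X$, with $$\|\eta\|_{Q,s;X}^2=\sum_\alpha\frac{q^{2s\alpha}}{|\alpha|!}\|\eta_\alpha\|_X^2<\infty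 .$$ Its dual $(\mathcal L)^{Q,s}$ relative to $L_2(\Omega)$ consists of the real series $\zeta=\sum_\alpha\zeta_\alpha\xi_\alpha$ with $\sum_\alpha|\alpha|!\,q^{-2s\alpha}\zeta_\alpha^2<\infty$, and $\langle\!\langle\eta,\zeta\rangle\!\rangle=\sum_\alpha\zeta_\alpha\eta_\alpha$. For $h\in\mathcal U$ put $\mathcal E_h=\exp(\dot W(h)-\frac12\|h\|^2_{\mathcal U})$, with coefficients $\mathbb E(\mathcal E_h\xi_\alpha)$; $h$ is sufficiently small relative to $Q$ if $\sum_kq_k^{2\rho}(h,\mathfrak u_k)_{\mathcal U}^2<1$ for some $\rho>0$. Let $\mathbf A(t):V\to V'$ and $\mathbf M(t):V\to V'\otimes\mathcal U$ be bounded linear operators such that $\mathbf Mv\in L_2((0,T);V'\otimes\mathcal U)$ for every $v\in\mathcal V(T)$, and write $\mathbf M(t)v=\sum_k(\mathbf M_k(t)v)\otimes\mathfrak u_k$. For operators $\mathbf B(t):V\to V'$, a solution of $U(t)=U_0+\int_0^t(\mathbf B(s)U(s)+F(s))\,ds$ is a $U\in\mathcal V(T)$ such that $\mathbf BU$ is Bochner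 integrable on $(0,T)$ and the equality holds in $V'$ for almost every $t\in(0,T)$. A solution of $$u(t)=u^0+\int_0^t\big(\mathbf A(s)u(s)+f(s)+\boldsymbol\delta(\mathbf M(s)u(s))\big)ds \qquad(1)$$ is a formal series $u$ with $u\in(\mathcal L)_{Q',r'}(\mathcal V(T))$ for some weight sequence $Q'$ and some $r'\in\mathbb R$, such that for every $h\in\mathcal U$ that is sufficiently small relative to $Q'$ and satisfies $\mathcal E_h\in(\mathcal L)^{Q',r'}$, the elements $u_h=\langle\!\langle u,\mathcal E_h\rangle\!\rangle\in\mathcal V(T)$, $u^0_h=\langle\!\langle u^0,\mathcal E_h\rangle\!\rangle\in H$, $f_h=\langle\!\langle f,\mathcal E_h\rangle\!\rangle\in\mathcal V'(T)$ exist (as unconditionally convergent sums) and $u_h$ solves $$u_h(t)=u^0_h+\int_0^t\big(\mathbf A(s)u_h(s)+f_h(s)+(\mathbf M(s)u_h(s),h)_{\mathcal U}\big)ds .$$ We then say that $u$ is a solution in $(\mathcal L)_{Q',r'}(\mathcal V(T))$. **Assumptions.** (A) For all $U_0\in H$, $F\in\mathcal V'(T)$ the equation $U(t)=U_0+\int_0^t(\mathbf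 A(s)U(s)+F(s))ds$ has a unique solution $U\in\mathcal V(T)$, and $\|U\|_{\mathcal V(T)}\le C(\mathbf A,T)(\|U_0\|_H+\|F\|_{\mathcal V'(T)})$ with $C(\mathbf A,T)$ independent of $U_0,F$. (M) There are numbers $C_k\ge0$ such that for all $k\ge1$ and $v\in\mathcal V(T)$ the solution $w$ of $w(t)=\int_0^t(\mathbf A(s)w(s)+\mathbf M_k(s)v(s))ds$ satisfies $\|w\|^2_{\mathcal V(T)}\le C_k^2\|v\|^2_{\mathcal V(T)}$. **Theorem.** Assume (A) and (M), and let $r>0$ and a weight sequence $Q$ satisfy $\sum_\alpha\frac1{q^{2r\alpha}\alpha!}<\infty$. 1. There are a weight sequence $Q^\circ$, a number $r^\circ<0$ and a constant $C>0$, depending only on $Q,r,T$ and the operators $\mathbf A,\mathbf M$ (and not on $u^0$, $f$ or the noise), such that for all $u^0\in(\mathcal L)_{Q,-r}(H)$ and $f\in(\mathcal L)_{Q,-r}(\mathcal V'(T))$ equation (1) has a unique solution $u$; it is a solution in $(\mathcal L)_{Q^\circ,r^\circ}(\mathcal V(T))$, and $$\|u\|^2_{Q^\circ,r^\circ;\mathcal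 V(T)}\le C\big(\|u^0\|^2_{Q,-r;H}+\|f\|^2_{Q,-r;\mathcal V'(T)}\big).$$ 2. Let $q^\circ_k=2k(1+C_k)$ and $Q^\circ=\{q_k^\circ\}$. There is a constant $C>0$, depending only on $Q,r,T,\mathbf A,\mathbf M$, such that for every $r^\circ<-2$ and all $u^0\in(\mathcal L)_{Q,r}(H)$, $f\in(\mathcal L)_{Q,r}(\mathcal V'(T))$ the unique solution $u$ of (1) is a solution in $(\mathcal L)_{Q^\circ,r^\circ}(\mathcal V(T))$, and $$\|u\|^2_{Q^\circ,r^\circ;\mathcal V(T)}\le C\big(\|u^0\|^2_{Q,r;H}+\|f\|^2_{Q,r;\mathcal V'(T)}\big).$$ -/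

import Mathlib

open MeasureTheory ProbabilityTheory
open scoped TensorProduct RealInnerProductSpace

noncomputable section

namespace SkorokhodEvolution

/-! ### Multi-indices, weights, and chaos spaces

The index `k : ℕ` stands for the positive integer `k + 1`: sequences indexed by `1, 2, 3, …` in the
text are indexed by `0, 1, 2, …` here. -/

/-- Multi-indices `α = (α₁, α₂, …)` of non-negative integers with `|α| = ∑ αₖ < ∞`. -/
abbrev MultiIndex : Type := ℕ →₀ ℕ

/-- `|α|!`. -/
def lengthFactorial (α : MultiIndex) : ℝ := ((α.sum fun _ n => n).factorial : ℝ)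

/-- `α! = ∏ₖ αₖ!`. -/
def multiFactorial (α : MultiIndex) : ℝ := α.prod fun _ n => (n.factorial : ℝ)

/-- A weight sequence: `qₖ ≥ 1` for all `k`. -/
def IsWeight (q : ℕ → ℝ) : Prop := ∀ k, 1 ≤ q k

/-- `q^{r α} = ∏ₖ qₖ^{r αₖ}`. -/
def weightPow (q : ℕ → ℝ) (r : ℝ) (α : MultiIndex) : ℝ := α.prod fun k n => q k ^ (r * (n : ℝ))

section Chaos

variable {X : Type*} [NormedAddCommGroup X]

/-- The terms of `‖η‖²_{Q,r;X} = ∑_α q^{2rα} ‖η_α‖² / |α|!` for the formal series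
`η = ∑_α η_α ξ_α`, which is represented by the family of its coefficients. -/
def chaosTerm (q : ℕ → ℝ) (r : ℝ) (η : MultiIndex → X) (α : MultiIndex) : ℝ :=
  weightPow q (2 * r) α / lengthFactorial α * ‖η α‖ ^ 2

/-- The formal series `η = ∑_α η_α ξ_α` belongs to `(L)_{Q,r}(X)`. -/
def MemChaos (q : ℕ → ℝ) (r : ℝ) (η : MultiIndex → X) : Prop := Summable (chaosTerm q r η)

/-- The squared norm of `(L)_{Q,r}(X)`. -/
def chaosNormSq (q : ℕ → ℝ) (r : ℝ) (η : MultiIndex → X) : ℝ := ∑' α, chaosTerm q r η α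

/-- The formal series `ζ = ∑_α ζ_α ξ_α` with real coefficients belongs to `(L)^{Q,r}`, the dual
space of `(L)_{Q,r}` relative to the inner product of `L₂(Ω)`. The duality between the two is
`⟨⟨η, ζ⟩⟩ = ∑_α ζ_α η_α`. -/
def MemDual (q : ℕ → ℝ) (r : ℝ) (ζ : MultiIndex → ℝ) : Prop :=
  Summable fun α => lengthFactorial α * weightPow q (-(2 * r)) α * ζ α ^ 2

/-- `x = ⟨⟨η, ζ⟩⟩`. -/
def IsPairing [NormedSpace ℝ X] (η : MultiIndex → X) (ζ : MultiIndex → ℝ) (x : X) : Prop :=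
  HasSum (fun α => ζ α • η α) x

end Chaos

/-! ### Gaussian white noise -/

section Noise

variable {U : Type*} [NormedAddCommGroup U] [InnerProductSpace ℝ U]
  {Ω : Type*} [MeasurableSpace Ω]

/-- `W = {W(h), h ∈ U}` is a zero-mean Gaussian family with `E (W(h) W(g)) = (h, g)`. -/
structure IsWhiteNoise (W : U → Ω → ℝ) (P : Measure Ω) : Prop where
  gaussian : IsGaussianProcess W P
  mean_zero : ∀ h, ∫ ω, W h ω ∂P = 0
  covariance : ∀ h g, ∫ ω, W h ω * W g ω ∂P = ⟪h, g⟫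

/-- The Cameron-Martin basis `ξ_α = ∏ₖ H_{αₖ}(ξₖ) / √(αₖ!)`, where `ξₖ = W(𝔲ₖ)` and `Hₙ` is the
`n`-th probabilists' Hermite polynomial. -/
def xi (𝔲 : HilbertBasis ℕ ℝ U) (W : U → Ω → ℝ) (α : MultiIndex) (ω : Ω) : ℝ :=
  α.prod fun k n =>
    Polynomial.aeval (W (𝔲 k) ω) (Polynomial.hermite n) / Real.sqrt (n.factorial : ℝ)

/-- The chaos coefficients `η_α = E (η ξ_α)` of a random variable. -/
def chaosCoeff (𝔲 : HilbertBasis ℕ ℝ U) (W : U → Ω → ℝ) (P : Measure Ω) (η : Ω → ℝ)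
    (α : MultiIndex) : ℝ :=
  ∫ ω, η ω * xi 𝔲 W α ω ∂P

/-- The stochastic exponential `E_h = exp (W(h) - ‖h‖² / 2)`. -/
def stochExp (W : U → Ω → ℝ) (h : U) (ω : Ω) : ℝ := Real.exp (W h ω - ‖h‖ ^ 2 / 2)

/-- `h` is sufficiently small relative to `Q`: for some `ρ > 0`, `h` is in the domain of `Λ_Q^ρ`,
where `Λ_Q 𝔲ₖ = qₖ 𝔲ₖ`, and `‖Λ_Q^ρ h‖² = ∑ₖ qₖ^{2ρ} (h, 𝔲ₖ)² < 1`. -/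
def IsSmall (𝔲 : HilbertBasis ℕ ℝ U) (q : ℕ → ℝ) (h : U) : Prop :=
  ∃ ρ : ℝ, 0 < ρ ∧ Summable (fun k => q k ^ (2 * ρ) * ⟪𝔲 k, h⟫ ^ 2) ∧
    ∑' k, q k ^ (2 * ρ) * ⟪𝔲 k, h⟫ ^ 2 < 1

end Noise

/-! ### The Hilbert tensor product -/

section Tensor

variable {E U : Type*} [NormedAddCommGroup E] [InnerProductSpace ℝ E] [CompleteSpace E]
  [NormedAddCommGroup U] [InnerProductSpace ℝ U]

/-- The Hilbert space tensor product: the completion of the algebraic one. -/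
abbrev HilbertTensor (E U : Type*) [NormedAddCommGroup E] [InnerProductSpace ℝ E]
    [NormedAddCommGroup U] [InnerProductSpace ℝ U] : Type _ :=
  UniformSpace.Completion (E ⊗[ℝ] U)

/-- The contraction `x ↦ (x, h)_U` from `E ⊗ U` to `E`: the adjoint of `e ↦ e ⊗ h`, that is, the
bounded operator with `(e ⊗ g, h)_U = (g, h)_U e`. -/
def contract (h : U) : HilbertTensor E U →L[ℝ] E :=
  ContinuousLinearMap.adjoint
    ((UniformSpace.Completion.toComplL (𝕜 := ℝ) (E := E ⊗[ℝ] U)).comp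
      ((TensorProduct.mkL ℝ E U).flip h))

theorem contract_tmul (h g : U) (e : E) :
    contract h ((e ⊗ₜ[ℝ] g : E ⊗[ℝ] U) : HilbertTensor E U) = ⟪g, h⟫ • e := by
  refine ext_inner_right ℝ fun v => ?_
  rw [contract, ContinuousLinearMap.adjoint_inner_left]
  simp [inner_smul_left, UniformSpace.Completion.inner_coe, mul_comm]

end Tensor

/-! ### Normal triples and evolution equations -/

/-- A normal triple `V ↪ H ↪ V'` of Hilbert spaces: both embeddings are dense and continuous, and
`V'` is the dual of `V` relative to the inner product of `H`, that is, `V'` is identified with the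
dual of `V` by a linear homeomorphism which sends `f ∈ H` to `(f, ·)_H`. (Hence
`|(f, v)_H| ≤ C ‖v‖_V ‖f‖_{V'}` with `C` the operator norm of `pairing`.) -/
structure NormalTriple (V H V' : Type*)
    [NormedAddCommGroup V] [InnerProductSpace ℝ V] [CompleteSpace V]
    [NormedAddCommGroup H] [InnerProductSpace ℝ H] [CompleteSpace H]
    [NormedAddCommGroup V'] [InnerProductSpace ℝ V'] [CompleteSpace V'] where
  toH : V →L[ℝ] H
  toH_injective : Function.Injective toH
  toH_denseRange : DenseRange toH
  toV' : H →L[ℝ] V'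
  toV'_injective : Function.Injective toV'
  toV'_denseRange : DenseRange toV'
  pairing : V' ≃L[ℝ] StrongDual ℝ V
  pairing_toV' : ∀ (f : H) (v : V), pairing (toV' f) v = ⟪f, toH v⟫

/-- The restriction of Lebesgue measure to `(0, T)`. -/
abbrev timeMeasure (T : ℝ) : Measure ℝ := volume.restrict (Set.Ioo 0 T)

/-- `L₂((0, T); X)`. -/
abbrev LTwo (T : ℝ) (X : Type*) [NormedAddCommGroup X] : Type _ := Lp X 2 (timeMeasure T)

section Equation

variable {V H V' U : Type*}
  [NormedAddCommGroup V] [InnerProductSpace ℝ V] [CompleteSpace V]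
  [NormedAddCommGroup H] [InnerProductSpace ℝ H] [CompleteSpace H]
  [NormedAddCommGroup V'] [InnerProductSpace ℝ V'] [CompleteSpace V']
  [NormedAddCommGroup U] [InnerProductSpace ℝ U]

/-- `u ∈ L₂((0, T); V)` solves the deterministic equation
`u(t) = u₀ + ∫₀ᵗ (B(s) u(s) + F(s)) ds` (the integral is a Bochner integral in `V'`, and the
equation holds for almost every `t`). -/
def IsDetSolution (N : NormalTriple V H V') (T : ℝ) (B : ℝ → V →L[ℝ] V')
    (u₀ : H) (F : LTwo T V') (u : LTwo T V) : Prop :=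
  Integrable (fun s => B s (u s)) (timeMeasure T) ∧
    ∀ᵐ t ∂(timeMeasure T),
      N.toV' (N.toH (u t)) = N.toV' u₀ + ∫ s in (0 : ℝ)..t, (B s (u s) + F s)

/-- Assumption (A): the deterministic equation is well posed in `L₂((0, T); V)`. -/
structure AssumptionA (N : NormalTriple V H V') (T : ℝ) (A : ℝ → V →L[ℝ] V') : Prop where
  existsUnique : ∀ (u₀ : H) (F : LTwo T V'), ∃! u : LTwo T V, IsDetSolution N T A u₀ F u
  bound : ∃ C : ℝ, ∀ (u₀ : H) (F : LTwo T V') (u : LTwo T V),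
    IsDetSolution N T A u₀ F u → ‖u‖ ≤ C * (‖u₀‖ + ‖F‖)

/-- The components of `M` in the basis `𝔲`, so that `M v = ∑ₖ (Mₖ v) ⊗ 𝔲ₖ`. -/
def component (𝔲 : HilbertBasis ℕ ℝ U) (M : ℝ → V →L[ℝ] HilbertTensor V' U) (k : ℕ) (s : ℝ) :
    V →L[ℝ] V' :=
  (contract (𝔲 k)).comp (M s)

/-- Assumption (M): the function `w(t) = ∫₀ᵗ Φ_{t,s} Mₖ(s) v(s) ds`, that is, the solution of
`w(t) = ∫₀ᵗ (A(s) w(s) + Mₖ(s) v(s)) ds`, satisfies `‖w‖² ≤ Cₖ² ‖v‖²` in `L₂((0, T); V)`, for all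
`v ∈ L₂((0, T); V)` and all `k`. -/
structure AssumptionM (N : NormalTriple V H V') (T : ℝ) (A : ℝ → V →L[ℝ] V')
    (𝔲 : HilbertBasis ℕ ℝ U) (M : ℝ → V →L[ℝ] HilbertTensor V' U) (C : ℕ → ℝ) : Prop where
  nonneg : ∀ k, 0 ≤ C k
  bound : ∀ (k : ℕ) (v : LTwo T V) (F : LTwo T V') (w : LTwo T V),
    (F =ᵐ[timeMeasure T] fun s => component 𝔲 M k s (v s)) →
      IsDetSolution N T A 0 F w → ‖w‖ ^ 2 ≤ C k ^ 2 * ‖v‖ ^ 2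

variable {Ω : Type*} [MeasurableSpace Ω]

/-- `u ∈ (L)_{Q,r}(L₂((0, T); V))` solves
`u(t) = u⁰ + ∫₀ᵗ (A(s) u(s) + f(s) + δ(M(s) u(s))) ds`: for every `h ∈ U` which is sufficiently
small relative to `Q` and for which the duality of `(L)_{Q,r}` with `E_h` is defined, the functions
`u_h = ⟨⟨u, E_h⟩⟩`, `u⁰_h = ⟨⟨u⁰, E_h⟩⟩`, `f_h = ⟨⟨f, E_h⟩⟩` exist and satisfy
`u_h(t) = u⁰_h + ∫₀ᵗ (A(s) u_h(s) + f_h(s) + (M(s) u_h(s), h)_U) ds`. -/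
structure IsSolutionIn (N : NormalTriple V H V') (T : ℝ) (A : ℝ → V →L[ℝ] V')
    (M : ℝ → V →L[ℝ] HilbertTensor V' U) (𝔲 : HilbertBasis ℕ ℝ U) (W : U → Ω → ℝ) (P : Measure Ω)
    (u₀ : MultiIndex → H) (f : MultiIndex → LTwo T V') (q : ℕ → ℝ) (r : ℝ)
    (u : MultiIndex → LTwo T V) : Prop where
  weight : IsWeight q
  mem : MemChaos q r u
  equation : ∀ h : U, IsSmall 𝔲 q h → MemDual q r (chaosCoeff 𝔲 W P (stochExp W h)) →
    ∃ (uh : LTwo T V) (u₀h : H) (fh : LTwo T V'),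
      IsPairing u (chaosCoeff 𝔲 W P (stochExp W h)) uh ∧
      IsPairing u₀ (chaosCoeff 𝔲 W P (stochExp W h)) u₀h ∧
      IsPairing f (chaosCoeff 𝔲 W P (stochExp W h)) fh ∧
      IsDetSolution N T (fun s => A s + (contract h).comp (M s)) u₀h fh uh

/-- `u` is a solution: it is one in `(L)_{Q',r'}(L₂((0, T); V))` for some weight sequence `Q'` and
some real `r'`. -/
def IsSolution (N : NormalTriple V H V') (T : ℝ) (A : ℝ → V →L[ℝ] V')
    (M : ℝ → V →L[ℝ] HilbertTensor V' U) (𝔲 : HilbertBasis ℕ ℝ U) (W : U → Ω → ℝ) (P : Measure Ω)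
    (u₀ : MultiIndex → H) (f : MultiIndex → LTwo T V') (u : MultiIndex → LTwo T V) : Prop :=
  ∃ (q' : ℕ → ℝ) (r' : ℝ), IsSolutionIn N T A M 𝔲 W P u₀ f q' r' u

end Equation

end SkorokhodEvolution

end

/-!
Pairing the equation with a stochastic exponential turns the Skorokhod integral into a deterministic
perturbation. Let `Φ (u₀, F)` be the solution operator of `u' = A u + F`, `u(0) = u₀`, which is
bounded by (A), and put `Λ h v = Φ (0, (M v, h))`. The closed graph theorem makes `Λ h` bounded and
continuous in `h`, and (M) says `‖Λ 𝔲ₖ‖ ≤ Cₖ`. The equation for `u_h` is then the fixed point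
equation `u_h = Φ (u⁰_h, f_h) + Λ h u_h` (`exists_perturbationOperator`).

The chaos coefficients of the stochastic exponential are `h^α / √(α!)` (`chaosCoeff_stochExp`), so
that `u_h` is a power series in the coordinates of `h`. Comparing coefficients along those `h` that
have finitely many nonzero coordinates gives the triangular system
`u_α = Φ (u⁰_α, f_α) + ∑ₖ √αₖ Λ 𝔲ₖ u_{α - εₖ}`, which determines `u`: this is uniqueness
(`IsSolution.eq_propagator`).

Conversely the solution of that system, `propagator`, lies in the required space. In the norm of
`(L)_{Q,r}` the weight `1 / |α|!` compensates exactly the factors `√αₖ`, by the Cauchy-Schwarz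
inequality and `∑ₖ αₖ = |α|`, and leaves the scalar recursion
`t_α ≤ 2 s_α + ∑ₖ 2 Cₖ² qₖ^{2r} t_{α - εₖ}` between the terms of the squared norms of the solution
and of the free term (`chaosNormSq_le_of_recursion`). It is contractive as soon as
`∑ₖ 2 Cₖ² qₖ^{2r} ≤ 1 / 2` (`summable_of_le_add_sum_sub_single`), and the weights `2 k (1 + Cₖ)` with
`r ≤ -2` achieve this with room to spare. For data with weight `Q` of exponent `-r` these weights
are multiplied by `qₖ`, so that the new norm is dominated by that of the data. Finally the series
for `u_h` converges absolutely for all admissible `h` and may be rearranged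
(`hasSum_monomialCoeff_sum_sqrt`), which gives back the fixed point equation.
-/

noncomputable section

namespace SkorokhodEvolution

/-! ### The chaos expansion of the stochastic exponential -/

theorem integrable_aeval_mul_exp_gaussianReal (p : Polynomial ℤ) (t : ℝ) :
    Integrable (fun x : ℝ => Polynomial.aeval x p * Real.exp (t * x)) (gaussianReal 0 1) := by
  have hpow : ∀ n : ℕ, Integrable (fun x : ℝ => x ^ n * Real.exp (t * x)) (gaussianReal 0 1) := by
    intro n
    refine integrable_pow_mul_exp_of_mem_interior_integrableExpSet (X := id) ?_ n
    have : integrableExpSet id (gaussianReal 0 1) = Set.univ := by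
      ext s; simpa [integrableExpSet] using integrable_exp_mul_gaussianReal s
    rw [this]; simp
  have : (fun x : ℝ => Polynomial.aeval x p * Real.exp (t * x)) =
      fun x => ∑ i ∈ Finset.range (p.natDegree + 1),
        (p.coeff i : ℝ) * (x ^ i * Real.exp (t * x)) := by
    ext x
    rw [Polynomial.aeval_eq_sum_range, Finset.sum_mul]
    refine Finset.sum_congr rfl fun i _ => ?_
    simp [mul_assoc]
  rw [this]
  exact integrable_finsetSum _ fun i _ => (hpow i).const_mul _

/-- Gaussian integration by parts: the adjoint of the derivative is `p ↦ X p - p'`, the operator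
that raises the degree of Hermite polynomials. -/
theorem integral_aeval_mul_exp_gaussianReal_ibp (p : Polynomial ℤ) (t : ℝ) :
    ∫ x, Polynomial.aeval x (Polynomial.X * p - Polynomial.derivative p) * Real.exp (t * x)
        ∂(gaussianReal 0 1) =
      t * ∫ x, Polynomial.aeval x p * Real.exp (t * x) ∂(gaussianReal 0 1) := by
  have hI : ∀ p : Polynomial ℤ, Integrable fun x : ℝ =>
      gaussianPDFReal 0 1 x * (Polynomial.aeval x p * Real.exp (t * x)) := by
    intro p
    have := integrable_aeval_mul_exp_gaussianReal p t
    rw [gaussianReal_of_var_ne_zero 0 one_ne_zero, integrable_withDensity_iff_integrable_smul'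
      (measurable_gaussianPDF 0 1) (ae_of_all _ fun x => gaussianPDF_lt_top)] at this
    simpa [gaussianPDF, ENNReal.toReal_ofReal (gaussianPDFReal_nonneg _ _ _)] using this
  have hderiv : ∀ x : ℝ, HasDerivAt
      (fun x : ℝ => gaussianPDFReal 0 1 x * (Polynomial.aeval x p * Real.exp (t * x)))
      (t * (gaussianPDFReal 0 1 x * (Polynomial.aeval x p * Real.exp (t * x))) -
        gaussianPDFReal 0 1 x * (Polynomial.aeval x
          (Polynomial.X * p - Polynomial.derivative p) * Real.exp (t * x))) x := by
    intro x
    have h1 : HasDerivAt (fun x : ℝ => gaussianPDFReal 0 1 x) (-x * gaussianPDFReal 0 1 x) x := by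
      have : HasDerivAt (fun x : ℝ => (√(2 * Real.pi * (1 : NNReal)))⁻¹ *
          Real.exp (- (x - 0) ^ 2 / (2 * (1 : NNReal))))
          ((√(2 * Real.pi * (1 : NNReal)))⁻¹ * (Real.exp (- (x - 0) ^ 2 / (2 * (1 : NNReal))) *
            (-(2 * (x - 0)) / (2 * (1 : NNReal))))) x := by
        refine HasDerivAt.const_mul _ (HasDerivAt.exp ?_)
        have := (((hasDerivAt_id x).sub_const 0).pow 2).neg.div_const (2 * ((1 : NNReal) : ℝ))
        convert! this using 1
        simp
      have hpdf : (fun x : ℝ => gaussianPDFReal 0 1 x) = fun x : ℝ =>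
          (√(2 * Real.pi * (1 : NNReal)))⁻¹ * Real.exp (- (x - 0) ^ 2 / (2 * (1 : NNReal))) := by
        ext x; rw [gaussianPDFReal]
      rw [hpdf]
      convert! this using 1
      rw [gaussianPDFReal]
      simp only [NNReal.coe_one]
      ring
    have h2 := (Polynomial.hasDerivAt_aeval p x)
    have h3 : HasDerivAt (fun x : ℝ => Real.exp (t * x)) (Real.exp (t * x) * t) x := by
      simpa using ((hasDerivAt_id x).const_mul t).exp
    convert! h1.mul (h2.mul h3) using 1
    simp only [map_sub, map_mul, Polynomial.aeval_X, Pi.mul_apply]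
    ring
  have h0 := integral_eq_zero_of_hasDerivAt_of_integrable hderiv
    (((hI p).const_mul t).sub (hI _)) (hI p)
  rw [integral_sub ((hI p).const_mul t) (hI _), integral_const_mul] at h0
  simp only [integral_gaussianReal_eq_integral_smul one_ne_zero, smul_eq_mul]
  linarith

/-- The generating-function identity `E (exp (t ξ) Hₙ(ξ)) = tⁿ exp (t² / 2)` for a standard normal
variable `ξ`. -/
theorem integral_hermite_mul_exp_gaussianReal (n : ℕ) (t : ℝ) :
    ∫ x, Polynomial.aeval x (Polynomial.hermite n) * Real.exp (t * x) ∂(gaussianReal 0 1) =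
      t ^ n * Real.exp (t ^ 2 / 2) := by
  induction n with
  | zero =>
    have := congrFun (mgf_id_gaussianReal (μ := 0) (v := 1)) t
    simp [mgf] at this
    simp [this]
  | succ n ih =>
    rw [Polynomial.hermite_succ, integral_aeval_mul_exp_gaussianReal_ibp, ih, pow_succ]; ring

section Noise

variable {U : Type*} [NormedAddCommGroup U] [InnerProductSpace ℝ U]
  {Ω : Type*} [MeasurableSpace Ω]

/-- The normalized monomial `a^α / √(α!) = ∏ₖ aₖ^{αₖ} / √(αₖ!)`. -/
def monomialCoeff (a : ℕ → ℝ) (α : MultiIndex) : ℝ :=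
  α.prod fun k n => a k ^ n / Real.sqrt (n.factorial : ℝ)

theorem IsWhiteNoise.hasGaussianLaw {W : U → Ω → ℝ} {P : Measure Ω} (hW : IsWhiteNoise W P)
    {ι : Type*} [Fintype ι] (g : ι → U) : HasGaussianLaw (fun ω i => W (g i) ω) P := by
  classical
  let I : Finset U := Finset.univ.image g
  let L : (I → ℝ) →L[ℝ] (ι → ℝ) :=
    { toFun x i := x ⟨g i, by simp [I]⟩
      map_add' x y := by ext; simp
      map_smul' c x := by ext; simp }
  exact (hW.gaussian.hasGaussianLaw I).map L

theorem IsWhiteNoise.memLp {W : U → Ω → ℝ} {P : Measure Ω} (hW : IsWhiteNoise W P) (h : U) :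
    MemLp (W h) 2 P := by
  have := (hW.hasGaussianLaw (fun _ : Unit => h)).eval ()
  exact this.memLp_two

theorem IsWhiteNoise.cov {W : U → Ω → ℝ} {P : Measure Ω} [IsProbabilityMeasure P]
    (hW : IsWhiteNoise W P) (h g : U) : cov[W h, W g; P] = ⟪h, g⟫ := by
  rw [covariance_eq_sub (hW.memLp h) (hW.memLp g), hW.mean_zero, ← hW.covariance]
  simp

/-- The chaos expansion of the stochastic exponential: `E (E_h ξ_α) = h^α / √(α!)`. The residual
`W(h) - ∑ₖ (h, 𝔲ₖ) W(𝔲ₖ)`, over `k` in the support of `α`, is uncorrelated with the `W(𝔲ₖ)`, hence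
independent of them, and the expectation factors. -/
theorem chaosCoeff_stochExp {W : U → Ω → ℝ} {P : Measure Ω} [IsProbabilityMeasure P]
    (hW : IsWhiteNoise W P) (𝔲 : HilbertBasis ℕ ℝ U) (h : U) (α : MultiIndex) :
    chaosCoeff 𝔲 W P (stochExp W h) α = monomialCoeff (fun k => ⟪𝔲 k, h⟫) α := by
  classical
  let S := α.support
  let a : ℕ → ℝ := fun k => ⟪𝔲 k, h⟫
  let Z : Ω → ℝ := W h - ∑ k : S, a k • W (𝔲 k)
  let X : Option S → Ω → ℝ := fun o => o.elim Z (fun k => W (𝔲 k))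
  have hX : HasGaussianLaw (fun ω o => X o ω) P := by
    let g : Option S → U := fun o => o.elim h (fun k => 𝔲 k)
    let L : (Option S → ℝ) →L[ℝ] (Option S → ℝ) :=
      ContinuousLinearMap.pi fun o => o.elim
        (ContinuousLinearMap.proj none - ∑ k : S, a k • ContinuousLinearMap.proj (some k))
        (fun k => ContinuousLinearMap.proj (some k))
    have := (hW.hasGaussianLaw g).map L
    have heq : (fun ω o => X o ω) = L ∘ fun ω i => W (g i) ω := by
      funext ω o
      cases o <;> simp [X, L, g, Z]
    rw [heq]
    exact this
  have hmem : ∀ k : S, MemLp (a k • W (𝔲 k)) 2 P := fun k => (hW.memLp _).const_smul _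
  have hsum : MemLp (∑ k : S, a k • W (𝔲 k)) 2 P := memLp_finsetSum' _ fun k _ => hmem k
  have hZmem : MemLp Z 2 P := (hW.memLp h).sub hsum
  have horth : ∀ i j : ℕ, ⟪𝔲 i, 𝔲 j⟫ = if i = j then (1 : ℝ) else 0 :=
    orthonormal_iff_ite.mp 𝔲.orthonormal
  have hcovZ : ∀ g : U, cov[Z, W g; P] = ⟪h, g⟫ - ∑ k : S, a k * ⟪𝔲 k, g⟫ := by
    intro g
    simp only [Z]
    rw [covariance_sub_left (hW.memLp h) hsum (hW.memLp g), hW.cov,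
      covariance_sum_left (fun k => hmem k) (hW.memLp g)]
    simp [covariance_smul_left, hW.cov]
  have hZk : ∀ k : S, cov[Z, W (𝔲 k); P] = 0 := by
    intro k
    rw [hcovZ]
    simp [horth, a, real_inner_comm]
  have hvar : Var[Z; P] = ‖h‖ ^ 2 - ∑ k : S, a k ^ 2 := by
    rw [← covariance_self hZmem.aemeasurable]
    conv_lhs => arg 2; simp only [Z]
    rw [covariance_sub_right hZmem (hW.memLp h) hsum, covariance_sum_right (fun k => hmem k) hZmem]
    simp only [covariance_smul_right, hZk, hcovZ, real_inner_self_eq_norm_sq]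
    simp [a, sq]
  have hind : iIndepFun X P := by
    refine hX.iIndepFun_of_covariance_eq_zero fun i j hij => ?_
    rcases i with _ | i <;> rcases j with _ | j
    · exact absurd rfl hij
    · exact hZk j
    · simpa [X, covariance_comm] using hZk i
    · have : (i : ℕ) ≠ j := fun h => hij (by rw [Subtype.ext h])
      simp [X, hW.cov, horth, this]
  have hmean : ∫ ω, Z ω ∂P = 0 := by
    have h1 : Integrable (W h) P := (hW.memLp h).integrable one_le_two
    have h2 : ∀ k : S, Integrable (fun ω => a k * W (𝔲 k) ω) P := fun k =>
      ((hW.memLp _).integrable one_le_two).const_mul _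
    have : Z = fun ω => W h ω - ∑ k : S, a k * W (𝔲 k) ω := by ext; simp [Z]
    rw [this, integral_sub h1 (integrable_finsetSum _ fun k _ => h2 k),
      integral_finsetSum _ fun k _ => h2 k]
    simp [integral_const_mul, hW.mean_zero]
  have hlawZ : P.map Z = gaussianReal 0 (Var[Z; P]).toNNReal := by
    have := (hX.eval none).map_eq_gaussianReal
    simpa [X, hmean] using! this
  have hlawk : ∀ k : S, P.map (W (𝔲 k)) = gaussianReal 0 1 := by
    intro k
    have h1 := (hX.eval (some k)).map_eq_gaussianReal
    have h2 : Var[W (𝔲 k); P] = 1 := by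
      rw [← covariance_self (hW.memLp _).aemeasurable, hW.cov, horth]; simp
    simpa [X, hW.mean_zero, h2] using! h1
  -- the factors of the integrand, one for the residual and one for each `k` in the support
  let φ : Option S → ℝ → ℝ := fun o => o.elim (fun x => Real.exp (x - Var[Z; P] / 2)) fun k x =>
    Polynomial.aeval x (Polynomial.hermite (α k)) * Real.exp (a k * x) *
      (Real.exp (-(a k ^ 2 / 2)) / Real.sqrt ((α k).factorial : ℝ))
  have hφ : ∀ o, Continuous (φ o) := by
    rintro (_ | k)
    · simp only [φ, Option.elim]; fun_prop
    · simp only [φ, Option.elim]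
      exact ((Polynomial.continuous_aeval _).mul (by fun_prop)).mul continuous_const
  have hfac : ∀ ω, stochExp W h ω * xi 𝔲 W α ω = ∏ o, φ o (X o ω) := by
    intro ω
    rw [Fintype.prod_option]
    simp only [φ, X, Option.elim, Finset.prod_mul_distrib, Finset.prod_div_distrib,
      ← Real.exp_sum, Finset.sum_neg_distrib, hvar]
    rw [xi, Finsupp.prod, ← Finset.prod_coe_sort, Finset.prod_div_distrib, stochExp]
    have : Real.exp (W h ω - ‖h‖ ^ 2 / 2) =
        Real.exp (Z ω - (‖h‖ ^ 2 - ∑ k : S, a k ^ 2) / 2) *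
          Real.exp (∑ k : S, a k * W (𝔲 k) ω) * Real.exp (-∑ k : S, a k ^ 2 / 2) := by
      rw [← Real.exp_add, ← Real.exp_add]
      congr 1
      simp [Z, ← Finset.sum_div]; ring
    rw [this]
    ring
  rw [chaosCoeff]
  simp only [hfac]
  have hint := hind.integral_fun_prod_comp (f := φ) (fun o => hX.aemeasurable.eval o)
    (fun o => (hφ o).aestronglyMeasurable)
  rw [hint, Fintype.prod_option]
  have hnone : ∫ ω, φ none (X none ω) ∂P = 1 := by
    have h1 : mgf Z P 1 = _ := mgf_gaussianReal hlawZ 1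
    simp only [mgf, one_mul] at h1
    simp only [φ, X, Option.elim, Real.exp_sub, integral_div, h1]
    rw [Real.coe_toNNReal _ (variance_nonneg _ _)]
    simp
  have hsome : ∀ k : S, ∫ ω, φ (some k) (X (some k) ω) ∂P =
      a k ^ α k / Real.sqrt ((α k).factorial : ℝ) := by
    intro k
    have h1 : ∫ ω, φ (some k) (X (some k) ω) ∂P = ∫ x, φ (some k) x ∂(gaussianReal 0 1) := by
      rw [← hlawk k, integral_map (hW.memLp _).aemeasurable (hφ _).aestronglyMeasurable]
      rfl
    rw [h1]
    simp only [φ, Option.elim]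
    rw [integral_mul_const, integral_hermite_mul_exp_gaussianReal, Real.exp_neg]
    field_simp
  rw [hnone, one_mul, Finset.prod_congr rfl fun k _ => hsome k, monomialCoeff, Finsupp.prod]
  exact Finset.prod_coe_sort α.support fun k => a k ^ α k / Real.sqrt ((α k).factorial : ℝ)

end Noise

/-! ### Factorials and weights of multi-indices -/

theorem sub_single_add {α : MultiIndex} {k : ℕ} (hk : k ∈ α.support) :
    α - Finsupp.single k 1 + Finsupp.single k 1 = α := by
  refine tsub_add_cancel_of_le ?_
  rw [Finsupp.single_le_iff]
  exact Nat.one_le_iff_ne_zero.mpr (Finsupp.mem_support_iff.mp hk)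

theorem degree_sub_single {α : MultiIndex} {k : ℕ} (hk : k ∈ α.support) :
    (α - Finsupp.single k 1).degree + 1 = α.degree := by
  conv_rhs => rw [← sub_single_add hk]
  simp

theorem lengthFactorial_eq (α : MultiIndex) : lengthFactorial α = (α.degree.factorial : ℝ) := rfl

theorem lengthFactorial_pos (α : MultiIndex) : 0 < lengthFactorial α := by
  rw [lengthFactorial_eq]; positivity

theorem lengthFactorial_sub_single {α : MultiIndex} {k : ℕ} (hk : k ∈ α.support) :
    lengthFactorial α = α.degree * lengthFactorial (α - Finsupp.single k 1) := by
  rw [lengthFactorial_eq, lengthFactorial_eq, ← degree_sub_single hk, Nat.factorial_succ]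
  push_cast; ring

theorem weightPow_pos {q : ℕ → ℝ} (hq : ∀ k, 0 < q k) (r : ℝ) (α : MultiIndex) :
    0 < weightPow q r α :=
  Finset.prod_pos fun k _ => Real.rpow_pos_of_pos (hq k) _

theorem weightPow_single (q : ℕ → ℝ) (r : ℝ) (k : ℕ) :
    weightPow q r (Finsupp.single k 1) = q k ^ r := by
  simp [weightPow, Finsupp.prod_single_index]

theorem weightPow_add {q : ℕ → ℝ} (hq : ∀ k, 0 < q k) (r : ℝ) (α β : MultiIndex) :
    weightPow q r (α + β) = weightPow q r α * weightPow q r β := by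
  refine Finsupp.prod_add_index' (fun k => by simp) fun k m n => ?_
  rw [← Real.rpow_add (hq k)]; push_cast; ring_nf

theorem weightPow_sub_single {q : ℕ → ℝ} (hq : ∀ k, 0 < q k) (r : ℝ) {α : MultiIndex} {k : ℕ}
    (hk : k ∈ α.support) :
    weightPow q r α = q k ^ r * weightPow q r (α - Finsupp.single k 1) := by
  conv_lhs => rw [← sub_single_add hk]
  rw [weightPow_add hq, weightPow_single, mul_comm]

theorem weightPow_neg_mul {q : ℕ → ℝ} (hq : ∀ k, 0 < q k) (r : ℝ) (α : MultiIndex) :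
    weightPow q (-r) α * weightPow q r α = 1 := by
  rw [weightPow, weightPow, Finsupp.prod, Finsupp.prod, ← Finset.prod_mul_distrib]
  refine Finset.prod_eq_one fun k _ => ?_
  rw [← Real.rpow_add (hq k)]
  simp

theorem weightPow_le_weightPow {q p : ℕ → ℝ} (hq : ∀ k, 0 < q k) (hp : ∀ k, 0 < p k) {r s : ℝ}
    (h : ∀ k, q k ^ r ≤ p k ^ s) (α : MultiIndex) : weightPow q r α ≤ weightPow p s α := by
  refine Finset.prod_le_prod (fun k _ => (Real.rpow_pos_of_pos (hq k) _).le) fun k _ => ?_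
  simp only [Real.rpow_mul (hq k).le, Real.rpow_mul (hp k).le]
  exact Real.rpow_le_rpow (Real.rpow_pos_of_pos (hq k) _).le (h k) (Nat.cast_nonneg _)

theorem sum_sqrt_sq_support (α : MultiIndex) :
    ∑ k ∈ α.support, Real.sqrt (α k) ^ 2 = α.degree := by
  simp [Real.sq_sqrt, Finsupp.degree_apply]

/-- A discrete Gronwall inequality on multi-indices: if `a_α ≤ b_α + ∑ₖ dₖ a_{α - εₖ}` with
`∑ₖ dₖ ≤ 1 / 2`, then `∑ a ≤ 2 ∑ b`. Over a finite set of multi-indices that is closed downwards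
the last term is at most half of the left-hand side. -/
theorem summable_of_le_add_sum_sub_single {a b : MultiIndex → ℝ} {d : ℕ → ℝ} (ha : ∀ α, 0 ≤ a α)
    (hb : ∀ α, 0 ≤ b α) (hbs : Summable b) (hd : ∀ k, 0 ≤ d k)
    (hds : ∀ F : Finset ℕ, ∑ k ∈ F, d k ≤ 1 / 2)
    (h : ∀ α, a α ≤ b α + ∑ k ∈ α.support, d k * a (α - Finsupp.single k 1)) :
    Summable a ∧ ∑' α, a α ≤ 2 * ∑' α, b α := by
  classical
  have key : ∀ S : Finset MultiIndex, ∑ α ∈ S, a α ≤ 2 * ∑' α, b α := by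
    intro S
    -- the downward closure of `S`
    let D : Finset MultiIndex := S.biUnion fun α => Finset.Icc 0 α
    have hSD : S ⊆ D := fun α hα => Finset.mem_biUnion.mpr ⟨α, hα, by simp⟩
    have hD : ∀ α ∈ D, ∀ k, α - Finsupp.single k 1 ∈ D := by
      intro α hα k
      obtain ⟨β, hβ, hαβ⟩ := Finset.mem_biUnion.mp hα
      refine Finset.mem_biUnion.mpr ⟨β, hβ, ?_⟩
      rw [Finset.mem_Icc] at hαβ ⊢
      exact ⟨zero_le, tsub_le_self.trans hαβ.2⟩
    let K : Finset ℕ := D.biUnion fun α => α.support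
    have h1 : ∑ α ∈ D, ∑ k ∈ α.support, d k * a (α - Finsupp.single k 1) ≤
        1 / 2 * ∑ α ∈ D, a α := by
      have hswap : ∑ α ∈ D, ∑ k ∈ α.support, d k * a (α - Finsupp.single k 1) =
          ∑ k ∈ K, ∑ α ∈ D with k ∈ α.support, d k * a (α - Finsupp.single k 1) := by
        refine Finset.sum_comm' fun α k => ?_
        simp only [Finset.mem_filter, K, Finset.mem_biUnion]
        exact ⟨fun h => ⟨⟨h.1, h.2⟩, α, h⟩, fun h => h.1⟩
      rw [hswap]
      calc _ ≤ ∑ k ∈ K, d k * ∑ α ∈ D, a α := by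
            refine Finset.sum_le_sum fun k _ => ?_
            rw [← Finset.mul_sum]
            refine mul_le_mul_of_nonneg_left ?_ (hd k)
            have hinj : Set.InjOn (fun α : MultiIndex => α - Finsupp.single k 1)
                (D.filter fun α => k ∈ α.support) := by
              intro α hα β hβ hαβ
              simp only [Finset.coe_filter, Set.mem_ofPred_eq] at hα hβ hαβ
              rw [← sub_single_add hα.2, hαβ, sub_single_add hβ.2]
            rw [← Finset.sum_image (f := a) hinj]
            refine Finset.sum_le_sum_of_subset_of_nonneg ?_ fun α _ _ => ha α
            intro β hβ
            obtain ⟨α, hα, rfl⟩ := Finset.mem_image.mp hβ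
            exact hD α (Finset.mem_filter.mp hα).1 k
        _ = (∑ k ∈ K, d k) * ∑ α ∈ D, a α := by rw [Finset.sum_mul]
        _ ≤ 1 / 2 * ∑ α ∈ D, a α :=
            mul_le_mul_of_nonneg_right (hds K) (Finset.sum_nonneg fun α _ => ha α)
    have h2 : ∑ α ∈ D, a α ≤ ∑ α ∈ D, b α + 1 / 2 * ∑ α ∈ D, a α := by
      refine (Finset.sum_le_sum fun α _ => h α).trans ?_
      rw [Finset.sum_add_distrib]
      gcongr
    have h3 : ∑ α ∈ D, b α ≤ ∑' α, b α := hbs.sum_le_tsum D fun α _ => hb α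
    have h4 : ∑ α ∈ S, a α ≤ ∑ α ∈ D, a α :=
      Finset.sum_le_sum_of_subset_of_nonneg hSD fun α _ _ => ha α
    linarith
  exact ⟨summable_of_sum_le ha key, Real.tsum_le_of_sum_le ha key⟩

/-! ### Estimates in the chaos spaces -/

section Chaos

variable {X : Type*} [NormedAddCommGroup X]

theorem chaosTerm_nonneg {q : ℕ → ℝ} (hq : ∀ k, 0 < q k) (r : ℝ) (η : MultiIndex → X)
    (α : MultiIndex) : 0 ≤ chaosTerm q r η α :=
  mul_nonneg (div_nonneg (weightPow_pos hq _ _).le (lengthFactorial_pos α).le) (sq_nonneg _)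

theorem chaosNormSq_nonneg {q : ℕ → ℝ} (hq : ∀ k, 0 < q k) (r : ℝ) (η : MultiIndex → X) :
    0 ≤ chaosNormSq q r η :=
  tsum_nonneg fun α => chaosTerm_nonneg hq r η α

/-- A priori estimate for the propagator. The factors `√αₖ` are absorbed by the Cauchy-Schwarz
inequality and `∑ₖ αₖ = |α|`, which is the ratio of consecutive factors `|α|!` in the norm. -/
theorem chaosNormSq_le_of_recursion {u g : MultiIndex → X} {q : ℕ → ℝ} (hq : ∀ k, 0 < q k) {r : ℝ}
    {c : ℕ → ℝ}
    (h : ∀ α, ‖u α‖ ≤ ‖g α‖ +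
      ∑ k ∈ α.support, Real.sqrt (α k) * (c k * ‖u (α - Finsupp.single k 1)‖))
    (hc : ∀ F : Finset ℕ, ∑ k ∈ F, 2 * c k ^ 2 * q k ^ (2 * r) ≤ 1 / 2)
    (hg : MemChaos q r g) :
    MemChaos q r u ∧ chaosNormSq q r u ≤ 4 * chaosNormSq q r g := by
  have hrec : ∀ α, chaosTerm q r u α ≤ 2 * chaosTerm q r g α + ∑ k ∈ α.support,
      2 * c k ^ 2 * q k ^ (2 * r) * chaosTerm q r u (α - Finsupp.single k 1) := by
    intro α
    have hw : 0 ≤ weightPow q (2 * r) α / lengthFactorial α :=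
      div_nonneg (weightPow_pos hq _ _).le (lengthFactorial_pos α).le
    have hcs := Finset.sum_mul_sq_le_sq_mul_sq α.support (fun k => Real.sqrt (α k))
      (fun k => c k * ‖u (α - Finsupp.single k 1)‖)
    rw [sum_sqrt_sq_support] at hcs
    have hsq : ‖u α‖ ^ 2 ≤ 2 * ‖g α‖ ^ 2 +
        2 * (α.degree * ∑ k ∈ α.support, (c k * ‖u (α - Finsupp.single k 1)‖) ^ 2) := by
      refine (pow_le_pow_left₀ (norm_nonneg _) (h α) 2).trans ?_
      refine (add_sq_le (R := ℝ)).trans ?_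
      linarith
    calc chaosTerm q r u α ≤ weightPow q (2 * r) α / lengthFactorial α * (2 * ‖g α‖ ^ 2 +
          2 * (α.degree * ∑ k ∈ α.support, (c k * ‖u (α - Finsupp.single k 1)‖) ^ 2)) :=
          mul_le_mul_of_nonneg_left hsq hw
      _ = 2 * chaosTerm q r g α + ∑ k ∈ α.support,
          2 * (weightPow q (2 * r) α / lengthFactorial α) * α.degree *
            (c k * ‖u (α - Finsupp.single k 1)‖) ^ 2 := by
          rw [chaosTerm, ← Finset.mul_sum]; ring
      _ = _ := by
          congr 1
          refine Finset.sum_congr rfl fun k hk => ?_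
          have hdeg : (α.degree : ℝ) ≠ 0 := by
            rw [← degree_sub_single hk]; positivity
          have hl := (lengthFactorial_pos (α - Finsupp.single k 1)).ne'
          rw [chaosTerm, weightPow_sub_single hq _ hk, lengthFactorial_sub_single hk]
          field_simp
  have := summable_of_le_add_sum_sub_single (chaosTerm_nonneg hq r u)
    (fun α => mul_nonneg zero_le_two (chaosTerm_nonneg hq r g α)) (hg.mul_left 2)
    (fun k => mul_nonneg (mul_nonneg zero_le_two (sq_nonneg _)) (Real.rpow_pos_of_pos (hq k) _).le)
    hc hrec
  refine ⟨this.1, this.2.trans (le_of_eq ?_)⟩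
  rw [tsum_mul_left, chaosNormSq]; ring

/-- The duality between `(L)_{Q,r}(X)` and `(L)^{Q,r}` converges absolutely. -/
theorem MemChaos.summable_norm_smul [NormedSpace ℝ X] {q : ℕ → ℝ} (hq : ∀ k, 0 < q k) {r : ℝ}
    {η : MultiIndex → X} {ζ : MultiIndex → ℝ} (hη : MemChaos q r η) (hζ : MemDual q r ζ) :
    Summable fun α => ‖ζ α • η α‖ := by
  refine Summable.of_nonneg_of_le (fun _ => norm_nonneg _) (fun α => ?_) (hζ.add hη)
  have hl := lengthFactorial_pos α
  have hw := weightPow_pos hq (2 * r) α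
  have hinv : weightPow q (-(2 * r)) α = (weightPow q (2 * r) α)⁻¹ :=
    eq_inv_of_mul_eq_one_left (weightPow_neg_mul hq _ α)
  rw [norm_smul, Real.norm_eq_abs, chaosTerm, hinv, ← sq_abs (ζ α)]
  set x := |ζ α|
  set y := ‖η α‖
  set w := weightPow q (2 * r) α
  set l := lengthFactorial α
  -- Young's inequality, with the weight `l / w` of the dual norm and its inverse
  have h1 : x * y ≤ x ^ 2 * (l / w) + y ^ 2 * (w / l) := by
    have h2 : x * y = (x * Real.sqrt (l / w)) * (y * Real.sqrt (w / l)) := by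
      have : Real.sqrt (l / w) * Real.sqrt (w / l) = 1 := by
        rw [← Real.sqrt_mul (by positivity)]
        rw [show l / w * (w / l) = 1 by field_simp, Real.sqrt_one]
      linear_combination (-(x * y)) * this
    rw [← Real.sq_sqrt (show 0 ≤ l / w by positivity),
      ← Real.sq_sqrt (show 0 ≤ w / l by positivity)]
    nlinarith [sq_nonneg (x * Real.sqrt (l / w) - y * Real.sqrt (w / l)),
      sq_nonneg (x * Real.sqrt (l / w)), sq_nonneg (y * Real.sqrt (w / l))]
  refine h1.trans (le_of_eq ?_)
  field_simp

theorem MemChaos.mono {q p : ℕ → ℝ} (hq : ∀ k, 0 < q k) (hp : ∀ k, 0 < p k) {r s : ℝ}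
    (h : ∀ k, q k ^ (2 * r) ≤ p k ^ (2 * s)) {η : MultiIndex → X} (hη : MemChaos p s η) :
    MemChaos q r η := by
  refine Summable.of_nonneg_of_le (chaosTerm_nonneg hq r η) (fun α => ?_) hη
  have := lengthFactorial_pos α
  rw [chaosTerm, chaosTerm]
  gcongr
  exact weightPow_le_weightPow hq hp h α

theorem chaosNormSq_mono {q p : ℕ → ℝ} (hq : ∀ k, 0 < q k) (hp : ∀ k, 0 < p k) {r s : ℝ}
    (h : ∀ k, q k ^ (2 * r) ≤ p k ^ (2 * s)) {η : MultiIndex → X} (hη : MemChaos p s η) :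
    chaosNormSq q r η ≤ chaosNormSq p s η := by
  refine (hη.mono hq hp h).tsum_le_tsum (fun α => ?_) hη
  have := lengthFactorial_pos α
  rw [chaosTerm, chaosTerm]
  gcongr
  exact weightPow_le_weightPow hq hp h α

end Chaos

theorem monomialCoeff_zero (a : ℕ → ℝ) : monomialCoeff a 0 = 1 := Finsupp.prod_zero_index

theorem monomialCoeff_mul_sqrt (a : ℕ → ℝ) {α : MultiIndex} {k : ℕ} (hk : k ∈ α.support) :
    monomialCoeff a α * Real.sqrt (α k) = a k * monomialCoeff a (α - Finsupp.single k 1) := by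
  set β := α - Finsupp.single k 1 with hβ
  have hα : α = β + Finsupp.single k 1 := (sub_single_add hk).symm
  have hk1 : α k = β k + 1 := by rw [hα]; simp
  have herase : α.erase k = β.erase k := by
    rw [hα]
    ext j
    by_cases hj : j = k
    · simp [hj]
    · simp [Finsupp.erase_ne hj]
  have hone : ∀ i : ℕ, a i ^ 0 / Real.sqrt ((Nat.factorial 0 : ℕ) : ℝ) = 1 := by simp
  rw [monomialCoeff, monomialCoeff, ← Finsupp.mul_prod_erase' α k _ hone,
    ← Finsupp.mul_prod_erase' β k _ hone, herase, hk1, Nat.factorial_succ]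
  push_cast
  rw [Real.sqrt_mul (by positivity)]
  have h1 : Real.sqrt ((β k : ℝ) + 1) ≠ 0 := by positivity
  field_simp
  ring

theorem monomialCoeff_eq_zero {a : ℕ → ℝ} {α : MultiIndex} {k : ℕ} (hk : k ∈ α.support)
    (ha : a k = 0) : monomialCoeff a α = 0 := by
  refine Finset.prod_eq_zero hk ?_
  simp only [ha]
  rw [zero_pow (Finsupp.mem_support_iff.mp hk), zero_div]

theorem monomialCoeff_smul (t : ℝ) (a : ℕ → ℝ) (α : MultiIndex) :
    monomialCoeff (t • a) α = t ^ α.degree * monomialCoeff a α := by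
  rw [monomialCoeff, monomialCoeff, Finsupp.prod, Finsupp.prod, Finsupp.degree_apply,
    ← Finset.prod_pow_eq_pow_sum, ← Finset.prod_mul_distrib]
  refine Finset.prod_congr rfl fun k _ => ?_
  simp [mul_pow, mul_div_assoc]

/-- If the stochastic exponential of `h` has a duality with `(L)_{Q,r}`, then
`∑ₖ qₖ^{-2r} (h, 𝔲ₖ)² < ∞`: these are its terms of length one. -/
theorem MemDual.summable_sq {q a : ℕ → ℝ} {r : ℝ} (h : MemDual q r (monomialCoeff a)) :
    Summable fun k => q k ^ (-(2 * r)) * a k ^ 2 := by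
  have := h.comp_injective (i := fun k : ℕ => (Finsupp.single k 1 : MultiIndex))
    (Finsupp.single_left_injective one_ne_zero)
  refine this.congr fun k => ?_
  simp [weightPow_single, monomialCoeff, Finsupp.prod_single_index, lengthFactorial,
    Finsupp.sum_single_index]

/-- The multinomial series `∑_α (|α|! / α!) y^α`, with `yₖ = qₖ^{-2r} aₖ²`, converges if
`∑ₖ yₖ ≤ 1 / 2`. -/
theorem memDual_monomialCoeff {q a : ℕ → ℝ} (hq : ∀ k, 0 < q k) {r : ℝ}
    (h : ∀ F : Finset ℕ, ∑ k ∈ F, q k ^ (-(2 * r)) * a k ^ 2 ≤ 1 / 2) :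
    MemDual q r (monomialCoeff a) := by
  let b : MultiIndex → ℝ := fun α => if α = 0 then 1 else 0
  have hb : Summable b := by
    refine summable_of_ne_finset_zero (s := {0}) fun α hα => ?_
    simp only [Finset.mem_singleton] at hα
    simp [b, hα]
  refine (summable_of_le_add_sum_sub_single (b := b)
    (d := fun k => q k ^ (-(2 * r)) * a k ^ 2) (fun α => ?_) (fun α => ?_) hb (fun k => ?_)
    h fun α => ?_).1
  · exact mul_nonneg (mul_nonneg (lengthFactorial_pos α).le (weightPow_pos hq _ α).le) (sq_nonneg _)
  · simp only [b]; split_ifs <;> norm_num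
  · exact mul_nonneg (Real.rpow_pos_of_pos (hq k) _).le (sq_nonneg _)
  · by_cases hα : α = 0
    · subst hα
      simp [b, monomialCoeff_zero, weightPow, lengthFactorial]
    · have hdeg : 0 < (α.degree : ℝ) := by
        rw [Nat.cast_pos]
        exact Nat.pos_of_ne_zero fun h => hα ((Finsupp.degree_eq_zero_iff α).mp h)
      simp only [b, hα, if_false, zero_add]
      refine le_of_mul_le_mul_left (le_of_eq ?_) hdeg
      conv_lhs => rw [← sum_sqrt_sq_support α, Finset.sum_mul]
      rw [Finset.mul_sum]
      refine Finset.sum_congr rfl fun k hk => ?_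
      have h1 := monomialCoeff_mul_sqrt a hk
      rw [weightPow_sub_single hq _ hk, lengthFactorial_sub_single hk]
      linear_combination (α.degree * lengthFactorial (α - Finsupp.single k 1) *
        (q k ^ (-(2 * r)) * weightPow q (-(2 * r)) (α - Finsupp.single k 1))) *
        (monomialCoeff a α * Real.sqrt (α k) + a k * monomialCoeff a (α - Finsupp.single k 1)) * h1

/-! ### Uniqueness of power series in several variables -/

theorem coeff_eq_zero_of_hasSum_pow {c : ℕ → ℝ}
    (h : ∀ t : ℝ, |t| ≤ 1 → HasSum (fun n => t ^ n * c n) 0) (n : ℕ) : c n = 0 := by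
  induction n using Nat.strong_induction_on with
  | _ n ih =>
    have hs : Summable fun j => ‖c (j + n + 1)‖ := by
      have := (h 1 (by simp)).summable
      simp only [one_pow, one_mul] at this
      exact ((summable_nat_add_iff (n + 1)).mpr this).norm
    have key : ∀ t : ℝ, 0 < t → t ≤ 1 → |c n| ≤ t * ∑' j, ‖c (j + n + 1)‖ := by
      intro t ht ht1
      have h0 := h t (by rwa [abs_of_pos ht])
      have h1 := (hasSum_nat_add_iff' (n + 1)).mpr h0
      rw [Finset.sum_range_succ, Finset.sum_eq_zero fun i hi => by
        rw [ih i (Finset.mem_range.mp hi), mul_zero]] at h1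
      have h2 : |t ^ n * c n| ≤ ∑' j, t ^ (n + 1) * ‖c (j + n + 1)‖ := by
        have h3 : ‖0 - (0 + t ^ n * c n)‖ ≤ ∑' j, t ^ (n + 1) * ‖c (j + n + 1)‖ := by
          rw [← h1.tsum_eq]
          refine tsum_of_norm_bounded (hs.mul_left _).hasSum fun j => ?_
          rw [norm_mul, ← add_assoc, Real.norm_of_nonneg (by positivity)]
          refine mul_le_mul_of_nonneg_right ?_ (norm_nonneg _)
          exact pow_le_pow_of_le_one ht.le ht1 (by omega)
        simpa using h3
      rw [tsum_mul_left, abs_mul, abs_of_pos (by positivity), pow_succ, mul_assoc] at h2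
      exact le_of_mul_le_mul_left h2 (by positivity)
    have hlim : Filter.Tendsto (fun t : ℝ => t * ∑' j, ‖c (j + n + 1)‖)
        (nhdsWithin 0 (Set.Ioi 0)) (nhds 0) := by
      have : Filter.Tendsto (fun t : ℝ => t * ∑' j, ‖c (j + n + 1)‖) (nhds 0) (nhds (0 * _)) :=
        Filter.tendsto_id.mul_const _
      rw [zero_mul] at this
      exact this.mono_left nhdsWithin_le_nhds
    have : |c n| ≤ 0 := by
      refine ge_of_tendsto hlim ?_
      filter_upwards [Ioo_mem_nhdsGT (zero_lt_one (α := ℝ))] with t ht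
      exact key t ht.1 ht.2.le
    exact abs_eq_zero.mp (le_antisymm this (abs_nonneg _))

/-- A power series in finitely many variables, with coefficients in a normed space, that vanishes
near the origin is zero. Restricting it to the rays through the origin isolates its homogeneous
components, which are polynomials. -/
theorem eq_zero_of_hasSum_monomialCoeff {X : Type*} [NormedAddCommGroup X] [NormedSpace ℝ X]
    {D : MultiIndex → X} {S : Finset ℕ} {ε : ℝ} (hε : 0 < ε)
    (h : ∀ a : ℕ → ℝ, (∀ k ∉ S, a k = 0) → (∀ k, |a k| ≤ ε) →
      HasSum (fun α => monomialCoeff a α • D α) 0)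
    {α : MultiIndex} (hα : α.support ⊆ S) : D α = 0 := by
  classical
  refine (SeparatingDual.eq_zero_iff_forall_dual_eq_zero (R := ℝ) _).mpr fun φ => ?_
  have hφ : ∀ a : ℕ → ℝ, (∀ k ∉ S, a k = 0) → (∀ k, |a k| ≤ ε) →
      HasSum (fun α => monomialCoeff a α * φ (D α)) 0 := by
    intro a ha ha'
    simpa using (h a ha ha').mapL φ
  -- the homogeneous components vanish
  have hhom : ∀ a : ℕ → ℝ, (∀ k ∉ S, a k = 0) → (∀ k, |a k| ≤ ε) → ∀ n : ℕ,
      ∑ α ∈ S.finsuppAntidiag n, monomialCoeff a α * φ (D α) = 0 := by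
    intro a ha ha'
    refine coeff_eq_zero_of_hasSum_pow fun t ht => ?_
    have h1 := hφ (t • a) (fun k hk => by simp [ha k hk]) fun k => by
      rw [Pi.smul_apply, smul_eq_mul, abs_mul]
      exact (mul_le_of_le_one_left (abs_nonneg _) ht).trans (ha' k)
    have h2 := (Equiv.hasSum_iff (Equiv.sigmaFiberEquiv
      (fun α : MultiIndex => α.degree))).mpr h1
    refine h2.sigma fun n => ?_
    have h3 : HasSum (fun α => if α.degree = n then t ^ n * (monomialCoeff a α * φ (D α)) else 0)
        (t ^ n * ∑ α ∈ S.finsuppAntidiag n, monomialCoeff a α * φ (D α)) := by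
      have h4 : t ^ n * ∑ α ∈ S.finsuppAntidiag n, monomialCoeff a α * φ (D α) =
          ∑ α ∈ S.finsuppAntidiag n,
            if α.degree = n then t ^ n * (monomialCoeff a α * φ (D α)) else 0 := by
        rw [Finset.mul_sum]
        refine Finset.sum_congr rfl fun α hα => ?_
        have : α.degree = n := (Finset.mem_finsuppAntidiag'.mp hα).1
        rw [if_pos this]
      rw [h4]
      refine hasSum_sum_of_ne_finset_zero fun α hα => ?_
      split_ifs with hd
      · have : ¬ α.support ⊆ S := fun hS => hα (Finset.mem_finsuppAntidiag'.mpr ⟨hd, hS⟩)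
        obtain ⟨k, hk, hkS⟩ := Finset.not_subset.mp this
        rw [monomialCoeff_eq_zero hk (ha k hkS)]
        simp
      · rfl
    have hind : (fun α => if α.degree = n then t ^ n * (monomialCoeff a α * φ (D α)) else 0) =
        {α : MultiIndex | α.degree = n}.indicator
          fun α => t ^ n * (monomialCoeff a α * φ (D α)) := by
      ext α; simp [Set.indicator_apply]
    rw [hind] at h3
    have h5 := hasSum_subtype_iff_indicator.mpr h3
    convert! h5 using 1
    ext ⟨α, hα⟩
    simp only [Function.comp_apply, Equiv.sigmaFiberEquiv_apply, monomialCoeff_smul]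
    rw [show α.degree = n from hα, mul_assoc]
  let p : MvPolynomial ℕ ℝ := ∑ β ∈ S.finsuppAntidiag α.degree,
    MvPolynomial.monomial β ((∏ k ∈ β.support, Real.sqrt ((β k).factorial : ℝ))⁻¹ * φ (D β))
  have hp : p = 0 := by
    refine MvPolynomial.funext_set (fun _ : ℕ => Set.Icc (-ε) ε)
      (fun _ => Set.Icc_infinite (by linarith)) fun x hx => ?_
    let a : ℕ → ℝ := fun k => if k ∈ S then x k else 0
    have ha := hhom a (fun k hk => by simp [a, hk]) (fun k => by
      simp only [a]
      split_ifs
      · exact abs_le.mpr (hx k trivial)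
      · simpa using hε.le) α.degree
    rw [map_zero, ← ha, map_sum]
    refine Finset.sum_congr rfl fun β hβ => ?_
    have hβS := (Finset.mem_finsuppAntidiag'.mp hβ).2
    have : monomialCoeff a β = (∏ k ∈ β.support, x k ^ β k) *
        (∏ k ∈ β.support, Real.sqrt ((β k).factorial : ℝ))⁻¹ := by
      rw [monomialCoeff, Finsupp.prod, Finset.prod_div_distrib, div_eq_mul_inv]
      congr 1
      exact Finset.prod_congr rfl fun k hk => by simp [a, hβS hk]
    rw [MvPolynomial.eval_monomial, this, Finsupp.prod]
    ring
  have hcoeff := congrArg (MvPolynomial.coeff α) hp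
  have hmem : α ∈ S.finsuppAntidiag α.degree := Finset.mem_finsuppAntidiag'.mpr ⟨rfl, hα⟩
  simp only [p, MvPolynomial.coeff_sum, MvPolynomial.coeff_monomial, Finset.sum_ite_eq', hmem,
    if_true, MvPolynomial.coeff_zero] at hcoeff
  refine (mul_eq_zero.mp hcoeff).resolve_left (inv_ne_zero ?_)
  exact Finset.prod_ne_zero_iff.mpr fun k _ => by positivity

/-! ### The deterministic equation -/

section Operators

variable {V H V' U : Type*}
  [NormedAddCommGroup V] [InnerProductSpace ℝ V] [CompleteSpace V]
  [NormedAddCommGroup H] [InnerProductSpace ℝ H] [CompleteSpace H]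
  [NormedAddCommGroup V'] [InnerProductSpace ℝ V'] [CompleteSpace V']
  [NormedAddCommGroup U] [InnerProductSpace ℝ U]

theorem LTwo.integrable {T : ℝ} {X : Type*} [NormedAddCommGroup X] (F : LTwo T X) :
    Integrable F (timeMeasure T) :=
  (Lp.memLp F).integrable one_le_two

theorem Ioc_subset_Ioo_of_mem {T t : ℝ} (ht : t ∈ Set.Ioo 0 T) : Set.Ioc 0 t ⊆ Set.Ioo 0 T :=
  fun _ hs => ⟨hs.1, hs.2.trans_lt ht.2⟩

theorem intervalIntegrable_of_mem_Ioo {T t : ℝ} {X : Type*} [NormedAddCommGroup X] {F : ℝ → X}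
    (hF : Integrable F (timeMeasure T)) (ht : t ∈ Set.Ioo 0 T) :
    IntervalIntegrable F volume 0 t := by
  rw [intervalIntegrable_iff_integrableOn_Ioc_of_le ht.1.le]
  exact hF.mono_measure (Measure.restrict_mono (Ioc_subset_Ioo_of_mem ht) le_rfl)

theorem intervalIntegral_congr_timeMeasure {T t : ℝ} {X : Type*} [NormedAddCommGroup X]
    [NormedSpace ℝ X] {F G : ℝ → X} (h : F =ᵐ[timeMeasure T] G) (ht : t ∈ Set.Ioo 0 T) :
    ∫ s in (0 : ℝ)..t, F s = ∫ s in (0 : ℝ)..t, G s := by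
  rw [intervalIntegral.integral_of_le ht.1.le, intervalIntegral.integral_of_le ht.1.le]
  exact integral_congr_ae (ae_mono (Measure.restrict_mono (Ioc_subset_Ioo_of_mem ht) le_rfl) h)

theorem ae_mem_timeMeasure (T : ℝ) : ∀ᵐ t ∂(timeMeasure T), t ∈ Set.Ioo 0 T :=
  ae_restrict_mem measurableSet_Ioo

theorem IsDetSolution.add {N : NormalTriple V H V'} {T : ℝ} {B : ℝ → V →L[ℝ] V'}
    {u₀ v₀ : H} {F G : LTwo T V'} {u v : LTwo T V} (hu : IsDetSolution N T B u₀ F u)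
    (hv : IsDetSolution N T B v₀ G v) : IsDetSolution N T B (u₀ + v₀) (F + G) (u + v) := by
  have hB : (fun s => B s ((u + v : LTwo T V) s)) =ᵐ[timeMeasure T]
      fun s => B s (u s) + B s (v s) := by
    filter_upwards [Lp.coeFn_add u v] with s hs
    rw [hs, Pi.add_apply, map_add]
  refine ⟨(hu.1.add hv.1).congr hB.symm, ?_⟩
  filter_upwards [hu.2, hv.2, ae_mem_timeMeasure T, Lp.coeFn_add u v] with t h1 h2 ht h3
  have hcongr : (fun s => B s ((u + v : LTwo T V) s) + (F + G : LTwo T V') s) =ᵐ[timeMeasure T]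
      fun s => (B s (u s) + F s) + (B s (v s) + G s) := by
    filter_upwards [hB, Lp.coeFn_add F G] with s hs hs'
    rw [hs, hs', Pi.add_apply]; abel
  have hadd := intervalIntegral.integral_add
    (intervalIntegrable_of_mem_Ioo (hu.1.add F.integrable) ht)
    (intervalIntegrable_of_mem_Ioo (hv.1.add G.integrable) ht)
  simp only [Pi.add_apply] at hadd
  rw [intervalIntegral_congr_timeMeasure hcongr ht, hadd, h3, Pi.add_apply, map_add, map_add,
    map_add, h1, h2]
  abel

theorem IsDetSolution.smul {N : NormalTriple V H V'} {T : ℝ} {B : ℝ → V →L[ℝ] V'}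
    {u₀ : H} {F : LTwo T V'} {u : LTwo T V} (c : ℝ) (hu : IsDetSolution N T B u₀ F u) :
    IsDetSolution N T B (c • u₀) (c • F) (c • u) := by
  have hB : (fun s => B s ((c • u : LTwo T V) s)) =ᵐ[timeMeasure T] fun s => c • B s (u s) := by
    filter_upwards [Lp.coeFn_smul c u] with s hs
    rw [hs, Pi.smul_apply, map_smul]
  refine ⟨(hu.1.smul c).congr hB.symm, ?_⟩
  filter_upwards [hu.2, ae_mem_timeMeasure T, Lp.coeFn_smul c u] with t h1 ht h3
  have hcongr : (fun s => B s ((c • u : LTwo T V) s) + (c • F : LTwo T V') s) =ᵐ[timeMeasure T]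
      fun s => c • (B s (u s) + F s) := by
    filter_upwards [hB, Lp.coeFn_smul c F] with s hs hs'
    rw [hs, hs', Pi.smul_apply, smul_add]
  rw [intervalIntegral_congr_timeMeasure hcongr ht, intervalIntegral.integral_smul, h3,
    Pi.smul_apply, map_smul, map_smul, map_smul, h1, smul_add]

/-- Moving a bounded perturbation of the operator to the right-hand side. -/
theorem isDetSolution_add_iff {N : NormalTriple V H V'} {T : ℝ} {A B : ℝ → V →L[ℝ] V'}
    {u₀ : H} {F G : LTwo T V'} {u : LTwo T V}
    (hG : G =ᵐ[timeMeasure T] fun s => B s (u s)) :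
    IsDetSolution N T (fun s => A s + B s) u₀ F u ↔ IsDetSolution N T A u₀ (F + G) u := by
  have hBint : Integrable (fun s => B s (u s)) (timeMeasure T) := G.integrable.congr hG
  refine and_congr ⟨fun h => ?_, fun h => ?_⟩ ?_
  · exact (h.sub hBint).congr (ae_of_all _ fun s => by simp)
  · exact h.add hBint
  · have hcongr : (fun s => (A s + B s) (u s) + F s) =ᵐ[timeMeasure T]
        fun s => A s (u s) + (F + G : LTwo T V') s := by
      filter_upwards [hG, Lp.coeFn_add F G] with s hs hs'
      rw [hs', Pi.add_apply, hs, add_apply]; abel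
    constructor
    all_goals
      intro h
      filter_upwards [h, ae_mem_timeMeasure T] with t h1 ht
      rw [h1, intervalIntegral_congr_timeMeasure hcongr ht]

/-- The solution operator `(u₀, F) ↦ u` of the deterministic equation `u' = A u + F`,
`u(0) = u₀`. -/
theorem AssumptionA.exists_solutionOperator {N : NormalTriple V H V'} {T : ℝ}
    {A : ℝ → V →L[ℝ] V'} (hA : AssumptionA N T A) :
    ∃ Φ : H × LTwo T V' →L[ℝ] LTwo T V, ∀ u₀ F u,
      IsDetSolution N T A u₀ F u ↔ u = Φ (u₀, F) := by
  choose sol hsol huniq using hA.existsUnique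
  obtain ⟨C, hC⟩ := hA.bound
  let L : H × LTwo T V' →ₗ[ℝ] LTwo T V :=
    { toFun p := sol p.1 p.2
      map_add' p p' := (huniq _ _ _ ((hsol p.1 p.2).add (hsol p'.1 p'.2))).symm
      map_smul' c p := (huniq _ _ _ ((hsol p.1 p.2).smul c)).symm }
  refine ⟨L.mkContinuous (|C| * 2) fun p => ?_, fun u₀ F u => ⟨fun h => huniq _ _ _ h, ?_⟩⟩
  · refine (hC _ _ _ (hsol p.1 p.2)).trans ?_
    rw [mul_assoc]
    refine mul_le_mul (le_abs_self C) ?_ (by positivity) (abs_nonneg C)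
    have h1 := norm_fst_le p
    have h2 := norm_snd_le p
    linarith
  · rintro rfl
    exact hsol u₀ F

/-- Multiplication by an operator-valued function that maps `L₂((0, T); V)` to `L₂((0, T); E)` is
bounded, by the closed graph theorem: an `L₂`-convergent sequence has a subsequence that converges
almost everywhere, and each `M s` is continuous. -/
theorem exists_multiplicationOperator {E : Type*} [NormedAddCommGroup E] [NormedSpace ℝ E]
    [CompleteSpace E] {T : ℝ} (M : ℝ → V →L[ℝ] E)
    (hM : ∀ v : LTwo T V, MemLp (fun s => M s (v s)) 2 (timeMeasure T)) :
    ∃ 𝓜 : LTwo T V →L[ℝ] LTwo T E, ∀ v, 𝓜 v =ᵐ[timeMeasure T] fun s => M s (v s) := by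
  let L : LTwo T V →ₗ[ℝ] LTwo T E :=
    { toFun v := (hM v).toLp _
      map_add' v w := by
        apply Lp.ext
        filter_upwards [(hM v).coeFn_toLp, (hM w).coeFn_toLp, (hM (v + w)).coeFn_toLp,
          Lp.coeFn_add v w, Lp.coeFn_add ((hM v).toLp _) ((hM w).toLp _)] with s h1 h2 h3 h4 h5
        rw [h5, h3, Pi.add_apply, h1, h2, h4, Pi.add_apply, map_add]
      map_smul' c v := by
        apply Lp.ext
        filter_upwards [(hM v).coeFn_toLp, (hM (c • v)).coeFn_toLp,
          Lp.coeFn_smul c v, Lp.coeFn_smul c ((hM v).toLp _)] with s h1 h3 h4 h5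
        rw [RingHom.id_apply, h5, h3, Pi.smul_apply, h1, h4, Pi.smul_apply, map_smul] }
  refine ⟨ContinuousLinearMap.ofSeqClosedGraph (g := L) fun v x y hv hy => ?_, fun v => ?_⟩
  · obtain ⟨ns, hns, h1⟩ := (tendstoInMeasure_of_tendsto_Lp hv).exists_seq_tendsto_ae
    have hy' := hy.comp hns.tendsto_atTop
    obtain ⟨ms, hms, h2⟩ := (tendstoInMeasure_of_tendsto_Lp hy').exists_seq_tendsto_ae
    apply Lp.ext
    have h3 : ∀ᵐ s ∂(timeMeasure T), ∀ n, L (v (ns (ms n))) s = M s (v (ns (ms n)) s) :=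
      ae_all_iff.mpr fun n => (hM _).coeFn_toLp
    filter_upwards [h1, h2, h3, (hM x).coeFn_toLp] with s hs1 hs2 hs3 hs4
    have h5 := ((M s).continuous.tendsto _).comp (hs1.comp hms.tendsto_atTop)
    refine (tendsto_nhds_unique hs2 ?_).trans hs4.symm
    refine h5.congr fun n => ?_
    exact (hs3 n).symm
  · exact (hM v).coeFn_toLp

theorem norm_contract_le (h : U) : ‖(contract h : HilbertTensor V' U →L[ℝ] V')‖ ≤
    ‖(TensorProduct.mkL ℝ V' U).flip‖ * ‖h‖ := by
  rw [contract, LinearIsometryEquiv.norm_map]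
  refine (ContinuousLinearMap.opNorm_comp_le _ _).trans ?_
  have h1 : ‖(UniformSpace.Completion.toComplL (𝕜 := ℝ) (E := V' ⊗[ℝ] U))‖ ≤ 1 :=
    (UniformSpace.Completion.toComplₗᵢ (𝕜 := ℝ) (E := V' ⊗[ℝ] U)).norm_toContinuousLinearMap_le
  have h2 := (TensorProduct.mkL ℝ V' U).flip.le_opNorm h
  calc _ ≤ 1 * ‖(TensorProduct.mkL ℝ V' U).flip h‖ :=
        mul_le_mul_of_nonneg_right h1 (norm_nonneg _)
    _ ≤ _ := by rwa [one_mul]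

theorem contract_add (h g : U) :
    (contract (h + g) : HilbertTensor V' U →L[ℝ] V') = contract h + contract g := by
  simp [contract, map_add, ContinuousLinearMap.comp_add]

theorem contract_smul (c : ℝ) (h : U) :
    (contract (c • h) : HilbertTensor V' U →L[ℝ] V') = c • contract h := by
  simp [contract]

/-- The reduction of the equation with multiplicative noise to a fixed point problem: with the
solution operator `Φ` of the unperturbed equation, `u` solves
`u' = A u + (M u, h) + F`, `u(0) = u₀`, iff `u = Φ (u₀, F) + Λ h u`, where
`Λ h v = Φ (0, (M v, h))` depends linearly on `h`, and `‖Λ 𝔲ₖ‖ ≤ Cₖ`. -/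
theorem exists_perturbationOperator {N : NormalTriple V H V'} {𝔲 : HilbertBasis ℕ ℝ U} {T : ℝ}
    {A : ℝ → V →L[ℝ] V'} {M : ℝ → V →L[ℝ] HilbertTensor V' U}
    (hMv : ∀ v : LTwo T V, MemLp (fun s => M s (v s)) 2 (timeMeasure T))
    {Ck : ℕ → ℝ} (hA : AssumptionA N T A) (hM : AssumptionM N T A 𝔲 M Ck) :
    ∃ (Φ : H × LTwo T V' →L[ℝ] LTwo T V) (Λ : U →L[ℝ] LTwo T V →L[ℝ] LTwo T V),
      (∀ k, ‖Λ (𝔲 k)‖ ≤ Ck k) ∧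
      ∀ h u₀ F u, IsDetSolution N T (fun s => A s + (contract h).comp (M s)) u₀ F u ↔
        u = Φ (u₀, F) + Λ h u := by
  obtain ⟨Φ, hΦ⟩ := hA.exists_solutionOperator
  obtain ⟨𝓜, h𝓜⟩ := exists_multiplicationOperator M hMv
  let G : U → LTwo T V →L[ℝ] LTwo T V' := fun h =>
    ((contract h : HilbertTensor V' U →L[ℝ] V').compLpL 2 (timeMeasure T)).comp 𝓜
  have hG : ∀ h v, G h v =ᵐ[timeMeasure T] fun s => (contract h).comp (M s) (v s) := by
    intro h v
    filter_upwards [(contract h : HilbertTensor V' U →L[ℝ] V').coeFn_compLpL (𝓜 v), h𝓜 v]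
      with s h1 h2
    exact h1.trans (congrArg (contract h) h2)
  let Λ₀ : U →ₗ[ℝ] LTwo T V →L[ℝ] LTwo T V :=
    { toFun h := (Φ.comp (ContinuousLinearMap.inr ℝ H (LTwo T V'))).comp (G h)
      map_add' h g := by
        simp only [G, contract_add, ContinuousLinearMap.add_compLpL, ContinuousLinearMap.add_comp,
          ContinuousLinearMap.comp_add]
      map_smul' c h := by
        simp only [G, contract_smul, ContinuousLinearMap.smul_compLpL,
          ContinuousLinearMap.smul_comp, ContinuousLinearMap.comp_smul, RingHom.id_apply] }
  let K : ℝ := ‖Φ.comp (ContinuousLinearMap.inr ℝ H (LTwo T V'))‖ *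
    (‖(TensorProduct.mkL ℝ V' U).flip‖ * ‖𝓜‖)
  have hK : ∀ h, ‖Λ₀ h‖ ≤ K * ‖h‖ := fun h => by
    calc ‖Λ₀ h‖ ≤ ‖Φ.comp (ContinuousLinearMap.inr ℝ H (LTwo T V'))‖ * ‖G h‖ :=
          ContinuousLinearMap.opNorm_comp_le _ _
      _ ≤ ‖Φ.comp (ContinuousLinearMap.inr ℝ H (LTwo T V'))‖ *
          (‖(TensorProduct.mkL ℝ V' U).flip‖ * ‖h‖ * ‖𝓜‖) := by
          gcongr
          refine (ContinuousLinearMap.opNorm_comp_le _ _).trans ?_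
          gcongr
          exact (ContinuousLinearMap.norm_compLpL_le _).trans (norm_contract_le h)
      _ = K * ‖h‖ := by simp only [K]; ring
  let Λ : U →L[ℝ] LTwo T V →L[ℝ] LTwo T V :=
    { toLinearMap := Λ₀
      cont := AddMonoidHomClass.continuous_of_bound Λ₀ K hK }
  have hΛ : ∀ h v, Λ h v = Φ (0, G h v) := fun h v => rfl
  refine ⟨Φ, Λ, fun k => ?_, fun h u₀ F u => ?_⟩
  · refine ContinuousLinearMap.opNorm_le_bound _ (hM.nonneg k) fun v => ?_
    have := hM.bound k v (G (𝔲 k) v) (Λ (𝔲 k) v) (hG _ _) ((hΦ _ _ _).mpr (hΛ _ _))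
    rw [← mul_pow] at this
    exact (sq_le_sq₀ (norm_nonneg _) (mul_nonneg (hM.nonneg k) (norm_nonneg v))).mp this
  · rw [isDetSolution_add_iff (hG h u), hΦ, hΛ, ← map_add]
    simp

end Operators

/-! ### The propagator system -/

section Propagator

variable {X : Type*} [NormedAddCommGroup X] [NormedSpace ℝ X]

/-- `n` steps of the recursion that defines `propagator`. -/
def propagatorStep (L : ℕ → X →L[ℝ] X) (g : MultiIndex → X) : ℕ → MultiIndex → X
  | 0, α => g α
  | n + 1, α => g α + ∑ k ∈ α.support,
      Real.sqrt (α k) • L k (propagatorStep L g n (α - Finsupp.single k 1))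

/-- The solution of the lower triangular system
`u_α = g_α + ∑ₖ √αₖ Lₖ u_{α - εₖ}`, by recursion on `|α|`. -/
def propagator (L : ℕ → X →L[ℝ] X) (g : MultiIndex → X) (α : MultiIndex) : X :=
  propagatorStep L g α.degree α

theorem propagator_eq (L : ℕ → X →L[ℝ] X) (g : MultiIndex → X) (α : MultiIndex) :
    propagator L g α = g α + ∑ k ∈ α.support,
      Real.sqrt (α k) • L k (propagator L g (α - Finsupp.single k 1)) := by
  rcases Nat.eq_zero_or_pos α.degree with h | h
  · rw [Finsupp.degree_eq_zero_iff] at h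
    subst h
    simp [propagator, propagatorStep]
  · obtain ⟨n, hn⟩ := Nat.exists_eq_succ_of_ne_zero h.ne'
    rw [propagator, hn, propagatorStep]
    congr 1
    refine Finset.sum_congr rfl fun k hk => ?_
    have := degree_sub_single hk
    have hd : (α - Finsupp.single k 1).degree = n := by omega
    rw [propagator, hd]

theorem eq_propagator_of_recursion {L : ℕ → X →L[ℝ] X} {g u : MultiIndex → X}
    (h : ∀ α, u α = g α + ∑ k ∈ α.support,
      Real.sqrt (α k) • L k (u (α - Finsupp.single k 1))) : u = propagator L g := by
  have key : ∀ n : ℕ, ∀ α : MultiIndex, α.degree = n → u α = propagator L g α := by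
    intro n
    induction n using Nat.strong_induction_on with
    | _ n ih =>
      intro α hα
      rw [h, propagator_eq]
      congr 1
      refine Finset.sum_congr rfl fun k hk => ?_
      have := degree_sub_single hk
      rw [ih _ (by omega) _ rfl]
  exact funext fun α => key _ α rfl

variable {U : Type*} [NormedAddCommGroup U] [InnerProductSpace ℝ U] [CompleteSpace X]

/-- Multi-indices with a distinguished element of the support are pairs `(k, β)`, by
`α = β + εₖ`. -/
def supportEquiv : (Σ α : MultiIndex, {k // k ∈ α.support}) ≃ ℕ × MultiIndex where
  toFun p := (p.2, p.1 - Finsupp.single (p.2 : ℕ) 1)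
  invFun p := ⟨p.2 + Finsupp.single p.1 1, p.1, by simp⟩
  left_inv := by
    rintro ⟨α, k, hk⟩
    have h := sub_single_add hk
    refine Sigma.ext h ?_
    refine (Subtype.heq_iff_coe_eq fun x => ?_).mpr rfl
    simp only [h]
  right_inv := by
    rintro ⟨k, β⟩
    simp

/-- The pairing of the series `∑ₖ √αₖ Λ 𝔲ₖ u_{α - εₖ}`, the coefficients of the Skorokhod
integral, with the stochastic exponential of `h` is `Λ h` applied to the pairing of `u`. -/
theorem hasSum_monomialCoeff_sum_sqrt (𝔲 : HilbertBasis ℕ ℝ U) (Λ : U →L[ℝ] X →L[ℝ] X) {h : U}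
    {u : MultiIndex → X} {x : X}
    (hu : HasSum (fun α => monomialCoeff (fun k => ⟪𝔲 k, h⟫) α • u α) x)
    (hn : Summable fun α => ‖monomialCoeff (fun k => ⟪𝔲 k, h⟫) α • u α‖)
    (hΛ : Summable fun k => ‖⟪𝔲 k, h⟫ • Λ (𝔲 k)‖) :
    HasSum (fun α => monomialCoeff (fun k => ⟪𝔲 k, h⟫) α • ∑ k ∈ α.support,
      Real.sqrt (α k) • Λ (𝔲 k) (u (α - Finsupp.single k 1))) (Λ h x) := by
  set a : ℕ → ℝ := fun k => ⟪𝔲 k, h⟫ with ha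
  let F : ℕ × MultiIndex → X := fun p => (a p.1 • Λ (𝔲 p.1)) (monomialCoeff a p.2 • u p.2)
  have hF : Summable F := by
    refine Summable.of_norm_bounded (hΛ.mul_of_nonneg hn (fun _ => norm_nonneg _)
      fun _ => norm_nonneg _) fun p => ?_
    exact ContinuousLinearMap.le_opNorm _ _
  have hΛh : HasSum (fun k => (a k • Λ (𝔲 k)) x) (Λ h x) := by
    have h1 := ((𝔲.hasSum_repr h).mapL Λ).mapL (ContinuousLinearMap.apply ℝ X x)
    simpa [𝔲.repr_apply_apply] using h1
  have hF' : HasSum F (Λ h x) := by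
    have h1 := hF.hasSum.prod_fiberwise fun k => hu.mapL (a k • Λ (𝔲 k))
    rw [hΛh.unique h1]
    exact hF.hasSum
  have h2 := (supportEquiv.hasSum_iff.mpr hF').sigma fun α => hasSum_fintype _
  convert! h2 using 1
  ext α
  rw [Finset.smul_sum, ← Finset.sum_coe_sort]
  refine Finset.sum_congr rfl fun k _ => ?_
  simp only [F, supportEquiv, Function.comp_apply, Equiv.coe_fn_mk,
    smul_apply, map_smul, smul_smul]
  rw [monomialCoeff_mul_sqrt a k.2, mul_comm]

end Propagator

/-! ### Uniqueness and existence -/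

section Equation

variable {V H V' U : Type*}
  [NormedAddCommGroup V] [InnerProductSpace ℝ V] [CompleteSpace V]
  [NormedAddCommGroup H] [InnerProductSpace ℝ H] [CompleteSpace H]
  [NormedAddCommGroup V'] [InnerProductSpace ℝ V'] [CompleteSpace V']
  [NormedAddCommGroup U] [InnerProductSpace ℝ U]
  {Ω : Type*} [MeasurableSpace Ω]

/-- All `h` with small coordinates in the span of finitely many basis vectors are admissible test
vectors: they are small relative to `Q`, and their stochastic exponential is in `(L)^{Q,r}`. -/
theorem exists_small_of_finset (𝔲 : HilbertBasis ℕ ℝ U) {q : ℕ → ℝ} (hq : ∀ k, 0 < q k) (r : ℝ)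
    (S : Finset ℕ) : ∃ ε : ℝ, 0 < ε ∧ ∀ a : ℕ → ℝ, (∀ k ∉ S, a k = 0) → (∀ k, |a k| ≤ ε) →
      ∃ h : U, (∀ k, ⟪𝔲 k, h⟫ = a k) ∧ IsSmall 𝔲 q h ∧ MemDual q r (monomialCoeff a) := by
  let w : ℕ → ℝ := fun k => q k ^ (2 * (1 : ℝ)) + q k ^ (-(2 * r))
  have hw1 : ∀ k, 0 < q k ^ (2 * (1 : ℝ)) := fun k => Real.rpow_pos_of_pos (hq k) _
  have hw2 : ∀ k, 0 < q k ^ (-(2 * r)) := fun k => Real.rpow_pos_of_pos (hq k) _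
  have hw : ∀ k, 0 ≤ w k := fun k => (add_pos (hw1 k) (hw2 k)).le
  have hK : 0 < 2 * (1 + ∑ k ∈ S, w k) := by
    have := Finset.sum_nonneg fun k (_ : k ∈ S) => hw k
    linarith
  refine ⟨Real.sqrt (1 / (2 * (1 + ∑ k ∈ S, w k))), by positivity, fun a ha ha' => ?_⟩
  have hsq : ∀ k, a k ^ 2 ≤ 1 / (2 * (1 + ∑ k ∈ S, w k)) := by
    intro k
    rw [← sq_abs, ← Real.sq_sqrt (show 0 ≤ 1 / (2 * (1 + ∑ k ∈ S, w k)) by positivity)]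
    exact pow_le_pow_left₀ (abs_nonneg _) (ha' k) 2
  have hsum : ∑ k ∈ S, w k * a k ^ 2 ≤ 1 / 2 := by
    calc ∑ k ∈ S, w k * a k ^ 2 ≤ ∑ k ∈ S, w k * (1 / (2 * (1 + ∑ k ∈ S, w k))) :=
          Finset.sum_le_sum fun k _ => mul_le_mul_of_nonneg_left (hsq k) (hw k)
      _ = (∑ k ∈ S, w k) / (2 * (1 + ∑ k ∈ S, w k)) := by rw [← Finset.sum_mul]; ring
      _ ≤ 1 / 2 := by rw [div_le_div_iff₀ hK two_pos]; linarith
  let h : U := ∑ k ∈ S, a k • 𝔲 k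
  have hh : ∀ k, ⟪𝔲 k, h⟫ = a k := by
    intro k
    simp only [h, inner_sum, inner_smul_right, orthonormal_iff_ite.mp 𝔲.orthonormal]
    by_cases hk : k ∈ S
    · simp [hk]
    · simp [hk, ha k hk]
  refine ⟨h, hh, ⟨1, one_pos, ?_, ?_⟩, memDual_monomialCoeff hq fun F => ?_⟩
  · refine summable_of_ne_finset_zero (s := S) fun k hk => ?_
    rw [hh, ha k hk]; simp
  · rw [tsum_eq_sum (s := S) fun k hk => by rw [hh, ha k hk]; simp]
    refine lt_of_le_of_lt ((Finset.sum_le_sum fun k _ => ?_).trans hsum) (by norm_num)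
    rw [hh]
    exact mul_le_mul_of_nonneg_right (le_add_of_nonneg_right (hw2 k).le) (sq_nonneg _)
  · calc ∑ k ∈ F, q k ^ (-(2 * r)) * a k ^ 2 ≤ ∑ k ∈ F ∪ S, q k ^ (-(2 * r)) * a k ^ 2 :=
          Finset.sum_le_sum_of_subset_of_nonneg Finset.subset_union_left fun k _ _ =>
            mul_nonneg (hw2 k).le (sq_nonneg _)
      _ = ∑ k ∈ S, q k ^ (-(2 * r)) * a k ^ 2 := by
          refine (Finset.sum_subset Finset.subset_union_right fun k _ hk => ?_).symm
          rw [ha k hk]; simp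
      _ ≤ ∑ k ∈ S, w k * a k ^ 2 := Finset.sum_le_sum fun k _ =>
            mul_le_mul_of_nonneg_right (le_add_of_nonneg_left (hw1 k).le) (sq_nonneg _)
      _ ≤ 1 / 2 := hsum

/-- The chaos coefficients of a solution satisfy the propagator system: test vectors `h` in the
span of finitely many `𝔲ₖ` turn the equation for `u_h` into an identity between power series in
the coordinates of `h`. -/
theorem IsSolution.eq_propagator {N : NormalTriple V H V'} {𝔲 : HilbertBasis ℕ ℝ U} {T : ℝ}
    {A : ℝ → V →L[ℝ] V'} {M : ℝ → V →L[ℝ] HilbertTensor V' U}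
    {Φ : H × LTwo T V' →L[ℝ] LTwo T V} {Λ : U →L[ℝ] LTwo T V →L[ℝ] LTwo T V}
    (hΦΛ : ∀ h u₀ F u, IsDetSolution N T (fun s => A s + (contract h).comp (M s)) u₀ F u ↔
      u = Φ (u₀, F) + Λ h u)
    {W : U → Ω → ℝ} {P : Measure Ω} [IsProbabilityMeasure P] (hW : IsWhiteNoise W P)
    {u₀ : MultiIndex → H} {f : MultiIndex → LTwo T V'} {u : MultiIndex → LTwo T V}
    (hu : IsSolution N T A M 𝔲 W P u₀ f u) :
    u = propagator (fun k => Λ (𝔲 k)) fun α => Φ (u₀ α, f α) := by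
  obtain ⟨q, r, hu⟩ := hu
  have hq : ∀ k, 0 < q k := fun k => one_pos.trans_le (hu.weight k)
  refine eq_propagator_of_recursion fun α => ?_
  obtain ⟨ε, hε, hsmall⟩ := exists_small_of_finset 𝔲 hq r α.support
  refine sub_eq_zero.mp (eq_zero_of_hasSum_monomialCoeff hε
    (D := fun β => u β - (Φ (u₀ β, f β) + ∑ k ∈ β.support,
      Real.sqrt (β k) • Λ (𝔲 k) (u (β - Finsupp.single k 1)))) (fun a ha ha' => ?_)
    (subset_refl α.support))
  obtain ⟨h, hh, hs, hdual⟩ := hsmall a ha ha'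
  have hcoeff : chaosCoeff 𝔲 W P (stochExp W h) = monomialCoeff a := by
    ext β; rw [chaosCoeff_stochExp hW]; simp only [hh]
  have heq := hu.equation h hs
  rw [hcoeff] at heq
  obtain ⟨uh, u₀h, fh, h1, h2, h3, h4⟩ := heq hdual
  rw [hΦΛ] at h4
  have h5 := (h2.prodMk h3).mapL Φ
  have h6 := hasSum_monomialCoeff_sum_sqrt 𝔲 Λ (h := h) (u := u) (x := uh)
    (by simp only [hh]; exact h1) (by simp only [hh]; exact hu.mem.summable_norm_smul hq hdual)
    (summable_of_ne_finset_zero (s := α.support) fun k hk => by rw [hh, ha k hk]; simp)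
  simp only [hh] at h6
  have h7 := h1.sub (h5.add h6)
  rw [← h4, sub_self] at h7
  refine h7.congr_fun fun β => ?_
  rw [← Prod.smul_mk, map_smul, smul_sub, smul_add]

/-- Well-posedness for a weight `Q°` that dominates the weight of the data and the bounds `Cₖ`. The
constant depends on the solution operator of the deterministic equation alone. -/
theorem exists_solution_of_weight {N : NormalTriple V H V'} {𝔲 : HilbertBasis ℕ ℝ U} {T : ℝ}
    {A : ℝ → V →L[ℝ] V'} {M : ℝ → V →L[ℝ] HilbertTensor V' U} {Ck : ℕ → ℝ}
    {Φ : H × LTwo T V' →L[ℝ] LTwo T V} {Λ : U →L[ℝ] LTwo T V →L[ℝ] LTwo T V}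
    (hΛ : ∀ k, ‖Λ (𝔲 k)‖ ≤ Ck k)
    (hΦΛ : ∀ h u₀ F u, IsDetSolution N T (fun s => A s + (contract h).comp (M s)) u₀ F u ↔
      u = Φ (u₀, F) + Λ h u)
    {q q₀ : ℕ → ℝ} {s r₀ : ℝ} (hq1 : IsWeight q) (hq₀1 : IsWeight q₀)
    (hcmp : ∀ k, q₀ k ^ (2 * r₀) ≤ q k ^ (2 * s))
    (hd : ∀ F : Finset ℕ, ∑ k ∈ F, 2 * Ck k ^ 2 * q₀ k ^ (2 * r₀) ≤ 1 / 2)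
    (hs : Summable fun k => Ck k * q₀ k ^ r₀)
    {P : Measure Ω} [IsProbabilityMeasure P] {W : U → Ω → ℝ} (hW : IsWhiteNoise W P)
    {u₀ : MultiIndex → H} {f : MultiIndex → LTwo T V'}
    (hu₀ : MemChaos q s u₀) (hf : MemChaos q s f) :
    ∃ u : MultiIndex → LTwo T V,
      IsSolutionIn N T A M 𝔲 W P u₀ f q₀ r₀ u ∧
      (∀ u' : MultiIndex → LTwo T V, IsSolution N T A M 𝔲 W P u₀ f u' → u' = u) ∧
      chaosNormSq q₀ r₀ u ≤ (4 * ‖Φ‖ ^ 2 + 1) * (chaosNormSq q s u₀ + chaosNormSq q s f) := by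
  have hq : ∀ k, 0 < q k := fun k => one_pos.trans_le (hq1 k)
  have hq₀ : ∀ k, 0 < q₀ k := fun k => one_pos.trans_le (hq₀1 k)
  have hu₀' := hu₀.mono hq₀ hq hcmp
  have hf' := hf.mono hq₀ hq hcmp
  let g : MultiIndex → LTwo T V := fun α => Φ (u₀ α, f α)
  have hgterm : ∀ α, chaosTerm q₀ r₀ g α ≤
      ‖Φ‖ ^ 2 * (chaosTerm q₀ r₀ u₀ α + chaosTerm q₀ r₀ f α) := by
    intro α
    have hw : 0 ≤ weightPow q₀ (2 * r₀) α / lengthFactorial α :=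
      div_nonneg (weightPow_pos hq₀ _ _).le (lengthFactorial_pos α).le
    have h1 : ‖g α‖ ^ 2 ≤ ‖Φ‖ ^ 2 * (‖u₀ α‖ ^ 2 + ‖f α‖ ^ 2) := by
      refine (pow_le_pow_left₀ (norm_nonneg _) (Φ.le_opNorm _) 2).trans ?_
      rw [mul_pow]
      refine mul_le_mul_of_nonneg_left ?_ (sq_nonneg _)
      rw [Prod.norm_def]
      rcases max_choice ‖u₀ α‖ ‖f α‖ with h | h <;> rw [h] <;>
        nlinarith [sq_nonneg ‖u₀ α‖, sq_nonneg ‖f α‖]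
    calc chaosTerm q₀ r₀ g α ≤ weightPow q₀ (2 * r₀) α / lengthFactorial α *
          (‖Φ‖ ^ 2 * (‖u₀ α‖ ^ 2 + ‖f α‖ ^ 2)) := mul_le_mul_of_nonneg_left h1 hw
      _ = _ := by rw [chaosTerm, chaosTerm]; ring
  have hgsum : Summable fun α => ‖Φ‖ ^ 2 * (chaosTerm q₀ r₀ u₀ α + chaosTerm q₀ r₀ f α) :=
    (hu₀'.add hf').mul_left _
  have hg : MemChaos q₀ r₀ g := Summable.of_nonneg_of_le (chaosTerm_nonneg hq₀ r₀ g) hgterm hgsum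
  have hgnorm : chaosNormSq q₀ r₀ g ≤
      ‖Φ‖ ^ 2 * (chaosNormSq q s u₀ + chaosNormSq q s f) := by
    calc chaosNormSq q₀ r₀ g ≤ ∑' α, ‖Φ‖ ^ 2 * (chaosTerm q₀ r₀ u₀ α + chaosTerm q₀ r₀ f α) :=
          hg.tsum_le_tsum hgterm hgsum
      _ = ‖Φ‖ ^ 2 * (chaosNormSq q₀ r₀ u₀ + chaosNormSq q₀ r₀ f) := by
          rw [tsum_mul_left, hu₀'.tsum_add hf']; rfl
      _ ≤ _ := by
          gcongr
          · exact chaosNormSq_mono hq₀ hq hcmp hu₀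
          · exact chaosNormSq_mono hq₀ hq hcmp hf
  set u := propagator (fun k => Λ (𝔲 k)) g with hu
  have hrec : ∀ α, ‖u α‖ ≤ ‖g α‖ + ∑ k ∈ α.support,
      Real.sqrt (α k) * (Ck k * ‖u (α - Finsupp.single k 1)‖) := by
    intro α
    rw [hu, propagator_eq]
    refine (norm_add_le _ _).trans (add_le_add le_rfl ((norm_sum_le _ _).trans ?_))
    refine Finset.sum_le_sum fun k _ => ?_
    rw [norm_smul, Real.norm_of_nonneg (Real.sqrt_nonneg _)]
    gcongr
    exact (Λ (𝔲 k)).le_of_opNorm_le (hΛ k) _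
  obtain ⟨humem, hunorm⟩ := chaosNormSq_le_of_recursion hq₀ hrec hd hg
  refine ⟨u, ⟨hq₀1, humem, fun h _ hdual => ?_⟩, fun u' hu' => hu'.eq_propagator hΦΛ hW, ?_⟩
  · have hcoeff : chaosCoeff 𝔲 W P (stochExp W h) = monomialCoeff fun k => ⟪𝔲 k, h⟫ :=
      funext fun α => chaosCoeff_stochExp hW 𝔲 h α
    rw [hcoeff] at hdual ⊢
    have hn := humem.summable_norm_smul hq₀ hdual
    have hpu := hn.of_norm.hasSum
    have hpu₀ := (hu₀'.summable_norm_smul hq₀ hdual).of_norm.hasSum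
    have hpf := (hf'.summable_norm_smul hq₀ hdual).of_norm.hasSum
    refine ⟨_, _, _, hpu, hpu₀, hpf, (hΦΛ _ _ _ _).mpr ?_⟩
    -- the terms of length one of the duality bound `(h, 𝔲ₖ)` by a multiple of `q°ₖ ^ r°`
    have hbound : Summable fun k => ‖⟪𝔲 k, h⟫ • Λ (𝔲 k)‖ := by
      have hsq := hdual.summable_sq
      have hsq0 : ∀ k, 0 ≤ q₀ k ^ (-(2 * r₀)) * ⟪𝔲 k, h⟫ ^ 2 := fun k =>
        mul_nonneg (Real.rpow_pos_of_pos (hq₀ k) _).le (sq_nonneg _)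
      set K := ∑' k, q₀ k ^ (-(2 * r₀)) * ⟪𝔲 k, h⟫ ^ 2
      have hK : ∀ k, |⟪𝔲 k, h⟫| ≤ Real.sqrt K * q₀ k ^ r₀ := by
        intro k
        have h1 : q₀ k ^ (-(2 * r₀)) * ⟪𝔲 k, h⟫ ^ 2 ≤ K := hsq.le_tsum k fun j _ => hsq0 j
        have hp : 0 < q₀ k ^ r₀ := Real.rpow_pos_of_pos (hq₀ k) _
        refine abs_le_of_sq_le_sq ?_ (by positivity)
        rw [mul_pow, Real.sq_sqrt ((hsq0 k).trans h1), ← Real.rpow_natCast (q₀ k ^ r₀),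
          ← Real.rpow_mul (hq₀ k).le]
        have h2 : q₀ k ^ (-(2 * r₀)) * q₀ k ^ (r₀ * ((2 : ℕ) : ℝ)) = 1 := by
          rw [← Real.rpow_add (hq₀ k)]; push_cast
          rw [show -(2 * r₀) + r₀ * 2 = 0 by ring, Real.rpow_zero]
        have hp2 : 0 < q₀ k ^ (r₀ * ((2 : ℕ) : ℝ)) := Real.rpow_pos_of_pos (hq₀ k) _
        calc ⟪𝔲 k, h⟫ ^ 2 = q₀ k ^ (-(2 * r₀)) * ⟪𝔲 k, h⟫ ^ 2 * q₀ k ^ (r₀ * ((2 : ℕ) : ℝ)) := by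
              linear_combination (-(⟪𝔲 k, h⟫ ^ 2)) * h2
          _ ≤ _ := mul_le_mul_of_nonneg_right h1 hp2.le
      refine Summable.of_nonneg_of_le (fun _ => ContinuousLinearMap.opNorm_nonneg _) (fun k => ?_)
        (hs.mul_left (Real.sqrt K))
      calc ‖⟪𝔲 k, h⟫ • Λ (𝔲 k)‖ ≤ |⟪𝔲 k, h⟫| * ‖Λ (𝔲 k)‖ :=
            ContinuousLinearMap.opNorm_smul_le _ _
        _ ≤ Real.sqrt K * q₀ k ^ r₀ * Ck k := mul_le_mul (hK k) (hΛ k)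
            (ContinuousLinearMap.opNorm_nonneg _) ((abs_nonneg _).trans (hK k))
        _ = _ := by ring
    have h1 := (hpu₀.prodMk hpf).mapL Φ
    have h2 := hasSum_monomialCoeff_sum_sqrt 𝔲 Λ hpu hn hbound
    -- the free term and the noise term add up to the series for `u_h`
    refine hpu.unique ((h1.add h2).congr_fun fun α => ?_)
    rw [← Prod.smul_mk, map_smul, ← smul_add]
    exact congrArg _ (propagator_eq _ _ α)
  · have h0 : 0 ≤ chaosNormSq q s u₀ + chaosNormSq q s f :=
      add_nonneg (chaosNormSq_nonneg hq s u₀) (chaosNormSq_nonneg hq s f)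
    linarith

end Equation

/-! ### The explicit weights -/

theorem sum_inv_sq_le_two (F : Finset ℕ) : ∑ k ∈ F, 1 / ((k : ℝ) + 1) ^ 2 ≤ 2 := by
  have hrange : ∀ n : ℕ, ∑ k ∈ Finset.range n, 1 / ((k : ℝ) + 1) ^ 2 ≤ 2 - 2 / ((n : ℝ) + 1) := by
    intro n
    induction n with
    | zero => norm_num
    | succ n ih =>
      rw [Finset.sum_range_succ]
      have hstep : 1 / ((n : ℝ) + 1) ^ 2 ≤ 2 / ((n : ℝ) + 1) - 2 / ((n + 1 : ℕ) + 1) := by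
        push_cast
        rw [div_sub_div _ _ (by positivity) (by positivity), div_le_div_iff₀ (by positivity)
          (by positivity)]
        have hn : (0 : ℝ) ≤ n := n.cast_nonneg
        nlinarith [mul_nonneg hn (sq_nonneg ((n : ℝ) + 1))]
      linarith
  obtain ⟨n, hn⟩ := F.exists_nat_subset_range
  have hpos : (0 : ℝ) ≤ 2 / ((n : ℝ) + 1) := by positivity
  have hsub : ∑ k ∈ F, 1 / ((k : ℝ) + 1) ^ 2 ≤ ∑ k ∈ Finset.range n, 1 / ((k : ℝ) + 1) ^ 2 :=
    Finset.sum_le_sum_of_subset_of_nonneg hn fun k _ _ => by positivity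
  linarith [hrange n]

section Weights

variable {Ck p : ℕ → ℝ} {r : ℝ}

theorem isWeight_of_le (hC : ∀ k, 0 ≤ Ck k) (hp : ∀ k : ℕ, 2 * ((k : ℝ) + 1) * (1 + Ck k) ≤ p k) :
    IsWeight p := by
  intro k
  refine le_trans ?_ (hp k)
  have hk : (0 : ℝ) ≤ k := k.cast_nonneg
  nlinarith [hC k, mul_nonneg hk (hC k)]

theorem mul_rpow_le_of_le (hC : ∀ k, 0 ≤ Ck k)
    (hp : ∀ k : ℕ, 2 * ((k : ℝ) + 1) * (1 + Ck k) ≤ p k) (hr : r ≤ -2) (k : ℕ) :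
    Ck k * p k ^ r ≤ 1 / 4 * (1 / ((k : ℝ) + 1) ^ 2) := by
  have hp1 : 1 ≤ p k := isWeight_of_le hC hp k
  have h1 : p k ^ r ≤ (p k ^ 2)⁻¹ := by
    refine (Real.rpow_le_rpow_of_exponent_le hp1 hr).trans (le_of_eq ?_)
    rw [Real.rpow_neg (by linarith), Real.rpow_two]
  have hb : 0 < 2 * ((k : ℝ) + 1) * (1 + Ck k) := by have := hC k; positivity
  have h2 : (p k ^ 2)⁻¹ ≤ ((2 * ((k : ℝ) + 1) * (1 + Ck k)) ^ 2)⁻¹ :=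
    inv_anti₀ (by positivity) (pow_le_pow_left₀ hb.le (hp k) 2)
  have hC1 : Ck k / (1 + Ck k) ^ 2 ≤ 1 := by
    rw [div_le_one (by have := hC k; positivity)]
    nlinarith [hC k]
  calc Ck k * p k ^ r ≤ Ck k * ((2 * ((k : ℝ) + 1) * (1 + Ck k)) ^ 2)⁻¹ :=
        mul_le_mul_of_nonneg_left (h1.trans h2) (hC k)
    _ = Ck k / (1 + Ck k) ^ 2 * (1 / 4 * (1 / ((k : ℝ) + 1) ^ 2)) := by
        have := hC k
        field_simp
        ring
    _ ≤ _ := mul_le_of_le_one_left (by positivity) hC1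

theorem summable_mul_rpow_of_le (hC : ∀ k, 0 ≤ Ck k)
    (hp : ∀ k : ℕ, 2 * ((k : ℝ) + 1) * (1 + Ck k) ≤ p k) (hr : r ≤ -2) :
    Summable fun k => Ck k * p k ^ r := by
  have hp1 := isWeight_of_le hC hp
  have hs : Summable fun k : ℕ => 1 / ((k : ℝ) + 1) ^ 2 :=
    summable_of_sum_le (fun k => by positivity) sum_inv_sq_le_two
  exact Summable.of_nonneg_of_le
    (fun k => mul_nonneg (hC k) (Real.rpow_nonneg (zero_le_one.trans (hp1 k)) _))
    (mul_rpow_le_of_le hC hp hr) (hs.mul_left _)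

theorem sum_sq_mul_rpow_le_of_le (hC : ∀ k, 0 ≤ Ck k)
    (hp : ∀ k : ℕ, 2 * ((k : ℝ) + 1) * (1 + Ck k) ≤ p k) (hr : r ≤ -2) (F : Finset ℕ) :
    ∑ k ∈ F, 2 * Ck k ^ 2 * p k ^ (2 * r) ≤ 1 / 2 := by
  have hp1 := isWeight_of_le hC hp
  have hterm : ∀ k ∈ F, 2 * Ck k ^ 2 * p k ^ (2 * r) ≤ 1 / 8 * (1 / ((k : ℝ) + 1) ^ 2) := by
    intro k _
    have hp0 : 0 ≤ p k := zero_le_one.trans (hp1 k)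
    have h1 := mul_rpow_le_of_le hC hp hr k
    have h0 : 0 ≤ Ck k * p k ^ r := mul_nonneg (hC k) (Real.rpow_nonneg hp0 _)
    have hk : 1 / ((k : ℝ) + 1) ^ 2 ≤ 1 := by
      rw [div_le_one (by positivity)]
      nlinarith [(k.cast_nonneg : (0 : ℝ) ≤ k)]
    have hk0 : 0 ≤ 1 / ((k : ℝ) + 1) ^ 2 := by positivity
    have hsq : p k ^ (2 * r) = (p k ^ r) ^ 2 := by
      rw [mul_comm, Real.rpow_mul hp0, Real.rpow_two]
    rw [hsq]
    nlinarith [mul_le_mul h1 h1 h0 (by positivity), mul_le_of_le_one_left hk0 hk]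
  refine (Finset.sum_le_sum hterm).trans ?_
  rw [← Finset.mul_sum]
  linarith [sum_inv_sq_le_two F]

end Weights

end SkorokhodEvolution

end

open SkorokhodEvolution in
theorem theorem4p2 {V H V' U : Type*}
    [NormedAddCommGroup V] [InnerProductSpace ℝ V] [CompleteSpace V]
    [NormedAddCommGroup H] [InnerProductSpace ℝ H] [CompleteSpace H]
    [NormedAddCommGroup V'] [InnerProductSpace ℝ V'] [CompleteSpace V']
    [NormedAddCommGroup U] [InnerProductSpace ℝ U] [CompleteSpace U]
    (N : NormalTriple V H V') (𝔲 : HilbertBasis ℕ ℝ U) (T : ℝ) (hT : 0 < T)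
    (A : ℝ → V →L[ℝ] V') (M : ℝ → V →L[ℝ] HilbertTensor V' U)
    (hMv : ∀ v : LTwo T V, MemLp (fun s => M s (v s)) 2 (timeMeasure T))
    (Ck : ℕ → ℝ) (hA : AssumptionA N T A) (hM : AssumptionM N T A 𝔲 M Ck)
    (q : ℕ → ℝ) (hq : IsWeight q) (r : ℝ) (hr : 0 < r)
    (hsum : Summable fun α : MultiIndex => 1 / (weightPow q (2 * r) α * multiFactorial α)) :
    -- general data
    (∃ (q₀ : ℕ → ℝ) (r₀ C : ℝ), IsWeight q₀ ∧ r₀ < 0 ∧ 0 < C ∧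
      ∀ {Ω : Type*} [MeasurableSpace Ω] (P : Measure Ω) [IsProbabilityMeasure P]
        (W : U → Ω → ℝ), IsWhiteNoise W P →
      ∀ (u₀ : MultiIndex → H) (f : MultiIndex → LTwo T V'),
        MemChaos q (-r) u₀ → MemChaos q (-r) f →
        ∃ u : MultiIndex → LTwo T V,
          IsSolutionIn N T A M 𝔲 W P u₀ f q₀ r₀ u ∧
          (∀ u' : MultiIndex → LTwo T V, IsSolution N T A M 𝔲 W P u₀ f u' → u' = u) ∧
          chaosNormSq q₀ r₀ u ≤ C * (chaosNormSq q (-r) u₀ + chaosNormSq q (-r) f)) ∧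
    -- data with finite `(Q, r)` norm: explicit weights
    (∃ C : ℝ, 0 < C ∧
      ∀ r₀ : ℝ, r₀ < -2 →
      ∀ {Ω : Type*} [MeasurableSpace Ω] (P : Measure Ω) [IsProbabilityMeasure P]
        (W : U → Ω → ℝ), IsWhiteNoise W P →
      ∀ (u₀ : MultiIndex → H) (f : MultiIndex → LTwo T V'),
        MemChaos q r u₀ → MemChaos q r f →
        ∃ u : MultiIndex → LTwo T V,
          IsSolutionIn N T A M 𝔲 W P u₀ f (fun k => 2 * ((k : ℝ) + 1) * (1 + Ck k)) r₀ u ∧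
          (∀ u' : MultiIndex → LTwo T V, IsSolution N T A M 𝔲 W P u₀ f u' → u' = u) ∧
          chaosNormSq (fun k => 2 * ((k : ℝ) + 1) * (1 + Ck k)) r₀ u ≤
            C * (chaosNormSq q r u₀ + chaosNormSq q r f)) := by
  have hq0 : ∀ k, 0 < q k := fun k => one_pos.trans_le (hq k)
  obtain ⟨Φ, Λ, hΛ, hΦΛ⟩ := exists_perturbationOperator hMv hA hM
  have hC : 0 < 4 * ‖Φ‖ ^ 2 + 1 := by positivity
  refine ⟨?_, ?_⟩
  -- the factor `q k` makes the new norm weaker than the norm of the data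
  · let p : ℕ → ℝ := fun k => q k * (2 * ((k : ℝ) + 1) * (1 + Ck k))
    have hbase : ∀ k : ℕ, 0 ≤ 2 * ((k : ℝ) + 1) * (1 + Ck k) := fun k => by
      have := hM.nonneg k
      positivity
    have hp : ∀ k : ℕ, 2 * ((k : ℝ) + 1) * (1 + Ck k) ≤ p k := fun k =>
      le_mul_of_one_le_left (hbase k) (hq k)
    have hpw : IsWeight p := isWeight_of_le hM.nonneg hp
    have hr₀ : -(r + 2) ≤ -2 := by linarith
    have hqp : ∀ k, q k ≤ p k := fun k => by
      refine le_mul_of_one_le_right (hq0 k).le ?_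
      exact isWeight_of_le hM.nonneg (fun _ => le_rfl) k
    refine ⟨p, -(r + 2), _, hpw, by linarith, hC, ?_⟩
    intro Ω _ P _ W hW u₀ f hu₀ hf
    refine exists_solution_of_weight hΛ hΦΛ hq hpw (fun k => ?_)
      (sum_sq_mul_rpow_le_of_le hM.nonneg hp hr₀) (summable_mul_rpow_of_le hM.nonneg hp hr₀)
      hW hu₀ hf
    exact (Real.rpow_le_rpow_of_exponent_le (hpw k) (by linarith)).trans
      (Real.rpow_le_rpow_of_nonpos (hq0 k) (hqp k) (by linarith))
  · refine ⟨_, hC, ?_⟩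
    intro r₀ hr₀ Ω _ P _ W hW u₀ f hu₀ hf
    have hpw : IsWeight fun k => 2 * ((k : ℝ) + 1) * (1 + Ck k) :=
      isWeight_of_le hM.nonneg fun _ => le_rfl
    refine exists_solution_of_weight hΛ hΦΛ hq hpw (fun k => ?_)
      (sum_sq_mul_rpow_le_of_le hM.nonneg (fun _ => le_rfl) hr₀.le)
      (summable_mul_rpow_of_le hM.nonneg (fun _ => le_rfl) hr₀.le) hW hu₀ hf
    exact (Real.rpow_le_one_of_one_le_of_nonpos (hpw k) (by linarith)).trans
      (Real.one_le_rpow (hq k) (by linarith))
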